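/- Let $d\in\mathbb N$, $\varepsilon>0$, $T>0$, and let $V_{\mathrm b}:\mathbb R^d\to\mathbb R$ be continuous and bounded. A *Schrödinger solution* is a function $\phi\in C([0,T];L^2(\mathbb R^d))$ that solves $$\mathrm i\varepsilon\,\partial_t\phi=-\tfrac{\varepsilon^2}{2}\Delta_x\phi+V_{\mathrm b}\phi$$ in the sense of tempered distributions in $x$ (for every Schwartz function $\chi$, $t\mapsto\int\phi(t)\chi$ is differentiable on $[0,T]$ with the derivative prescribed by the equation). A *Wigner solution* is a function $f\in C([0,T];L^2(\mathbb R^{2d}))$ that solves, in the same sense, $$\partial_t f+k\cdot\nabla_x f=\mathcal L_{V_{\mathrm b}}[f],\qquad \mathcal L_{V}[f](x,k)=\frac{\mathrm i}{(2\pi)^d}\int_{\mathbb R^{2d}}\frac{V(x+\frac{\varepsilon}{2}y)-V(x-\frac{\varepsilon}{2}y)}{\varepsilon}\,f(x,p)\,e^{\mathrm i y\cdot(k-p)}\,\mathrm dy\,\mathrm dp .$$ (The operator $\mathcal L_V$ is moved onto the test function by its anti-symmetry.) For $\phi_1,\phi_2\in L^2(\mathbb R^d)$ put $\langle\phi_1,\phi_2\rangle=\int\phi_1\overline{\phi_2}\,\mathrm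 dx$ and $$W[\phi_1,\phi_2](x,k)=\frac1{(2\pi)^d}\int_{\mathbb R^d}e^{\mathrm i k\cdot y}\,\phi_1\!\left(x-\tfrac{\varepsilon}{2}y\right)\overline{\phi_2}\!\left(x+\tfrac{\varepsilon}{2}y\right)\mathrm dy .$$ If $\phi_{\mathrm b}$ and $\psi$ are Schrödinger solutions with $\phi_{\mathrm b}(0)=\phi_{\mathrm I}$ and $\psi(T)=\psi_T$, the Schrödinger representative is $$R_{\mathrm S}[\phi_{\mathrm I},\psi_T]=\frac1{\mathrm i\varepsilon}\int_0^T\phi_{\mathrm b}(t)\,\overline{\psi(t)}\,\mathrm dt\in L^1(\mathbb R^d).$$ If $f_{\mathrm b}$ and $g$ are Wigner solutions with $f_{\mathrm b}(0)=f_{\mathrm I}$ and $g(T)=g_T$, the Wigner representative is $$R_{\mathrm W}[f_{\mathrm I},g_T](x)=\frac{\mathrm i}{(2\pi)^d}\int_{\mathbb R^{3d}\times[0,T]}e^{\mathrm i p\cdot(z-x)}\,\overline{g}(t,z,k)\,\frac{f_{\mathrm b}(t,z,k+\frac{\varepsilon}{2}p)-f_{\mathrm b}(t,z,k-\frac{\varepsilon}{2}p)}{\varepsilon}\,\mathrm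 dp\,\mathrm dz\,\mathrm dk\,\mathrm dt .$$ This is an oscillatory integral that defines a distribution in $x$: it is paired with a Schwartz function of $x$, the $x$-integral being carried out first. **Theorem.** Let $\phi_{\mathrm b},\phi_{\mathrm b}',\psi,\psi'$ be Schrödinger solutions with $\phi_{\mathrm b}(0)=\phi_{\mathrm I}$, $\phi_{\mathrm b}'(0)=\phi_{\mathrm I}'$, $\psi(T)=\psi_T$, $\psi'(T)=\psi_T'$, where $\phi_{\mathrm I},\phi_{\mathrm I}',\psi_T,\psi_T'\in L^2(\mathbb R^d)$. Let $f_{\mathrm I}=W[\phi_{\mathrm I},\psi'(0)]$ and $g_T=W[\psi_T,\phi_{\mathrm b}'(T)]$. Then there are a unique Wigner solution $f_{\mathrm b}$ with $f_{\mathrm b}(0)=f_{\mathrm I}$ and a unique Wigner solution $g$ with $g(T)=g_T$, and $$(2\pi\varepsilon)^d\,R_{\mathrm W}[f_{\mathrm I},g_T]=\langle\phi_{\mathrm I}',\psi'(0)\rangle\,R_{\mathrm S}[\phi_{\mathrm I},\psi_T]-\langle\phi_{\mathrm I},\psi(0)\rangle\,R_{\mathrm S}[\phi_{\mathrm I}',\psi_T']$$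 as distributions on $\mathbb R^d$. If moreover the integral over $(z,k,t)$ in $R_{\mathrm W}$ is integrable as a function of $p$, the identity holds for almost every $x$, with $R_{\mathrm W}(x)$ the iterated integral. In particular, every Wigner representative with data $f_{\mathrm I},g_T$ of this form is a linear combination of Schrödinger representatives. -/

import Mathlib

open MeasureTheory
open scoped ENNReal BoundedContinuousFunction ComplexConjugate

noncomputable section

namespace InverseWigner

/-- The configuration space `ℝ^d` with its Euclidean structure. -/
abbrev Pos (d : ℕ) : Type := EuclideanSpace ℝ (Fin d)

/-- The phase space `ℝ^d × ℝ^d`; a point is a pair `(x, k)`. -/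
abbrev Phase (d : ℕ) : Type := Pos d × Pos d

/-- `L²(ℝ^d)`, the space of wave functions. -/
abbrev WaveSpace (d : ℕ) : Type := Lp ℂ 2 (volume : Measure (Pos d))

/-- `L²(ℝ^{2d})`, the space of functions on phase space. -/
abbrev PhaseSpaceL2 (d : ℕ) : Type := Lp ℂ 2 (volume : Measure (Phase d))

/-- `e^{i θ}` for a real number `θ`. -/
def cis (θ : ℝ) : ℂ := Complex.exp (Complex.I * θ)

/-- `φ` is a solution in `C([0,T]; L²)` of the Schrödinger equation
`i ε ∂ₜ φ = - (ε² / 2) Δ φ + V φ` on `[0, T]`, in the sense of (tempered) distributions in `x`: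
for every test function `χ`, the function `t ↦ ∫ φ(t) χ` is differentiable on `[0, T]` and
`d/dt ∫ φ(t) χ = (1 / (i ε)) ∫ φ(t) (- (ε² / 2) Δ χ + V χ)`. -/
structure IsSchrodingerSolution {d : ℕ} (ε T : ℝ) (V : Pos d →ᵇ ℝ) (φ : ℝ → WaveSpace d) :
    Prop where
  continuousOn : ContinuousOn φ (Set.Icc 0 T)
  weak : ∀ χ : SchwartzMap (Pos d) ℂ, ∀ t ∈ Set.Icc 0 T,
    HasDerivWithinAt (fun s : ℝ => ∫ x, φ s x * χ x)
      ((1 / (Complex.I * ε)) *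
        ∫ x, φ t x * (-((ε : ℂ) ^ 2 / 2) * Laplacian.laplacian χ x + (V x : ℂ) * χ x))
      (Set.Icc 0 T) t

/-- The Wigner transform
`W[φ₁, φ₂](x, k) = (2π)^{-d} ∫ e^{i k·y} φ₁(x - (ε/2) y) conj (φ₂(x + (ε/2) y)) dy`.
For square integrable `φ₁`, `φ₂` and `ε ≠ 0` the integrand is integrable for every `(x, k)`. -/
def wignerTransform {d : ℕ} (ε : ℝ) (φ₁ φ₂ : WaveSpace d) (w : Phase d) : ℂ :=
  (1 / (2 * Real.pi : ℂ) ^ d) *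
    ∫ y : Pos d, cis (inner ℝ w.2 y) * φ₁ (w.1 - (ε / 2) • y) * conj (φ₂ (w.1 + (ε / 2) • y))

/-- The difference quotient `δ[V](x, y) = (V(x + (ε/2) y) - V(x - (ε/2) y)) / ε`. -/
def potentialDiff {d : ℕ} (ε : ℝ) (V : Pos d →ᵇ ℝ) (x y : Pos d) : ℝ :=
  (1 / ε) * (V (x + (ε / 2) • y) - V (x - (ε / 2) • y))

/-- The Wigner potential operator on a test function `χ` on phase space,
`L_V[χ](x, k) = i (2π)^{-d} ∫ ∫ δ[V](x, y) χ(x, p) e^{i y·(k - p)} dp dy`,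
where the inner integral in `p` is a Schwartz function of `y`. -/
def wignerOp {d : ℕ} (ε : ℝ) (V : Pos d →ᵇ ℝ) (χ : SchwartzMap (Phase d) ℂ) (w : Phase d) : ℂ :=
  (Complex.I / (2 * Real.pi : ℂ) ^ d) *
    ∫ y : Pos d, ∫ p : Pos d,
      (potentialDiff ε V w.1 y : ℂ) * χ (w.1, p) * cis (inner ℝ y (w.2 - p))

/-- The transport derivative `k · ∇ₓ χ` of a test function on phase space. -/
def transport {d : ℕ} (χ : SchwartzMap (Phase d) ℂ) (w : Phase d) : ℂ :=
  fderiv ℝ (χ : Phase d → ℂ) w (w.2, 0)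

/-- `f` is a solution in `C([0,T]; L²(ℝ^{2d}))` of the Wigner equation
`∂ₜ f + k · ∇ₓ f = L_V[f]` on `[0, T]`, in the sense of (tempered) distributions in `(x, k)`.
Both `k · ∇ₓ` and `L_V` are skew for the pairing `∫ f χ`, so that for every test function `χ`
`d/dt ∫ f(t) χ = ∫ f(t) (k · ∇ₓ χ - L_V[χ])`. -/
structure IsWignerSolution {d : ℕ} (ε T : ℝ) (V : Pos d →ᵇ ℝ) (f : ℝ → PhaseSpaceL2 d) :
    Prop where
  continuousOn : ContinuousOn f (Set.Icc 0 T)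
  weak : ∀ χ : SchwartzMap (Phase d) ℂ, ∀ t ∈ Set.Icc 0 T,
    HasDerivWithinAt (fun s : ℝ => ∫ w, f s w * χ w)
      (∫ w, f t w * (transport χ w - wignerOp ε V χ w))
      (Set.Icc 0 T) t

/-- The product `φ · conj ψ` of two square integrable functions, as an element of `L¹(ℝ^d)`. -/
def mulConj {d : ℕ} (φ ψ : WaveSpace d) : Lp ℂ 1 (volume : Measure (Pos d)) :=
  Integrable.toL1 (fun x => φ x * conj (ψ x))
    (by simpa [RCLike.inner_apply] using L2.integrable_inner (𝕜 := ℂ) ψ φ)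

/-- The Schrödinger representative `R_S = (1 / (i ε)) ∫₀ᵀ φ(t) conj (ψ(t)) dt`, an element of
`L¹(ℝ^d)`, for a background solution `φ` and an adjoint solution `ψ`. -/
def schrodingerRep {d : ℕ} (ε T : ℝ) (φ ψ : ℝ → WaveSpace d) :
    Lp ℂ 1 (volume : Measure (Pos d)) :=
  (1 / (Complex.I * ε)) • ∫ t in (0 : ℝ)..T, mulConj (φ t) (ψ t)

/-- The distribution `χ ↦ ∫ h χ` given by an integrable function `h`. -/
def toDistribution {d : ℕ} (h : Lp ℂ 1 (volume : Measure (Pos d))) (χ : SchwartzMap (Pos d) ℂ) :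
    ℂ :=
  ∫ x, h x * χ x

/-- The difference quotient
`D f(z, k, p) = (f(z, k + (ε/2) p) - f(z, k - (ε/2) p)) / ε`. -/
def phaseDiff {d : ℕ} (ε : ℝ) (f : PhaseSpaceL2 d) (z k p : Pos d) : ℂ :=
  (1 / (ε : ℂ)) * (f (z, k + (ε / 2) • p) - f (z, k - (ε / 2) • p))

/-- The Wigner representative
`R_W(x) = i (2π)^{-d} ∫ e^{i p·(z - x)} conj (g(z, k)) D f(z, k, p) dp dz dk dt` over
`ℝ^{3d} × [0, T]`, for a background solution `f` and an adjoint solution `g`, as a distribution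
in `x`. The integral is an oscillatory one: it is paired with a test function `χ`, the integral in
`x` being done first, which makes it absolutely convergent. -/
def wignerRep {d : ℕ} (ε T : ℝ) (f g : ℝ → PhaseSpaceL2 d) (χ : SchwartzMap (Pos d) ℂ) : ℂ :=
  (Complex.I / (2 * Real.pi : ℂ) ^ d) *
    ∫ p : Pos d, ∫ t in (0 : ℝ)..T, ∫ w : Phase d,
      (∫ x : Pos d, cis (inner ℝ p (w.1 - x)) * χ x) *
        conj (g t w) * phaseDiff ε (f t) w.1 w.2 p

/-- The integral over `(z, k, t)` in the Wigner representative at the point `x`, as a function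
of `p`. -/
def wignerRepIntegrand {d : ℕ} (ε T : ℝ) (f g : ℝ → PhaseSpaceL2 d) (x p : Pos d) : ℂ :=
  ∫ t in (0 : ℝ)..T, ∫ w : Phase d,
    cis (inner ℝ p (w.1 - x)) * conj (g t w) * phaseDiff ε (f t) w.1 w.2 p

/-- The Wigner representative at the point `x`, as an iterated integral. It is meaningful when
`wignerRepIntegrand ε T f g x` is integrable in `p`, a condition that does not depend on `x`. -/
def wignerRepAt {d : ℕ} (ε T : ℝ) (f g : ℝ → PhaseSpaceL2 d) (x : Pos d) : ℂ :=
  (Complex.I / (2 * Real.pi : ℂ) ^ d) * ∫ p : Pos d, wignerRepIntegrand ε T f g x p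

/-- The set of all Schrödinger representatives for the background potential `V`,
as distributions. -/
def schrodingerReps {d : ℕ} (ε T : ℝ) (V : Pos d →ᵇ ℝ) : Set (SchwartzMap (Pos d) ℂ → ℂ) :=
  {S | ∃ φ ψ : ℝ → WaveSpace d, IsSchrodingerSolution ε T V φ ∧ IsSchrodingerSolution ε T V ψ ∧
    S = toDistribution (schrodingerRep ε T φ ψ)}

end InverseWigner

end

open FourierTransform Filter Topology
open scoped ContDiff

noncomputable section

namespace InverseWigner

/-! ### Phases -/

/-! The background and adjoint Wigner solutions are themselves Wigner transforms of Schrödinger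
solutions, and for such functions the phase space integral in the representative factorises.

Undoing the free flow turns a weak Schrödinger solution into a curve differentiable in `L²` with
bounded generator `(iε)⁻¹ V` (`IsSchrodingerSolution.hasDerivWithinAt`). As `V` is real, this
generator is skew and inner products of solutions are conserved (`IsSchrodingerSolution.inner_eq`).
The Wigner transform converts the free flow into the shear `(x, k) ↦ (x + t k, k)`
(`wignerTransform_backFlow`) and the potential terms into `L_V` (`wignerTransform_potentialGen`),
which gives existence (`isWignerSolution_wignerL2`). Uniqueness is a Grönwall argument along the
free characteristics, where only `L_V`, bounded on `L²`, remains. Hence `f_b = W[φ_b, ψ']` and `g =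
W[ψ, φ_b']` on `[0, T]`.

At a fixed time, Parseval in `k` replaces the two Wigner transforms by products of wave functions at
the endpoints `x ∓ (ε/2) y` of a chord, and the shifts `k ± (ε/2) p` become the phases `p · (x ±
(ε/2) y)`. Each phase sees one endpoint only, so in endpoint coordinates the integral is an inner
product times the Fourier integral at `p` of a product of wave functions
(`integral_cis_mul_phaseDiff`). The inner products do not depend on time and leave the time
integral; Fourier inversion in `p` then yields the two Schrödinger representatives
(`wignerRep_wignerL2`). -/

lemma cis_add (a b : ℝ) : cis (a + b) = cis a * cis b := by
  simp [cis, mul_add, Complex.exp_add]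

@[simp] lemma cis_zero : cis 0 = 1 := by simp [cis]

@[simp] lemma norm_cis (a : ℝ) : ‖cis a‖ = 1 := by
  rw [cis, mul_comm, Complex.norm_exp_ofReal_mul_I]

lemma conj_cis (a : ℝ) : conj (cis a) = cis (-a) := by
  simp [cis, ← Complex.exp_conj]

@[fun_prop] lemma continuous_cis : Continuous cis := by
  unfold cis; fun_prop

lemma fourierChar_eq_cis (a : ℝ) : (Real.fourierChar a : ℂ) = cis (2 * Real.pi * a) := by
  rw [Real.fourierChar_apply, cis, mul_comm]

/-! ### Testing against smooth functions -/

section Test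

variable {E : Type*} [NormedAddCommGroup E] [NormedSpace ℝ E] [FiniteDimensional ℝ E]
  [MeasurableSpace E] [BorelSpace E] {μ : Measure E}

lemma ae_eq_of_integral_mul_test_eq {f g : E → ℂ}
    (hf : LocallyIntegrable f μ) (hg : LocallyIntegrable g μ)
    (h : ∀ η : E → ℂ, ContDiff ℝ ∞ η → HasCompactSupport η → ∫ x, f x * η x ∂μ = ∫ x, g x * η x ∂μ) :
    f =ᵐ[μ] g := by
  refine ae_eq_of_integral_contDiff_smul_eq hf hg fun η hη hs => ?_
  have := h (fun x => (η x : ℂ)) (Complex.ofRealCLM.contDiff.comp hη)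
    (hs.comp_left (g := ((↑) : ℝ → ℂ)) rfl)
  simpa [mul_comm, Complex.real_smul] using this

lemma Lp_eq_of_integral_mul_test_eq [IsLocallyFiniteMeasure μ] {f g : Lp ℂ 2 μ}
    (h : ∀ η : E → ℂ, ContDiff ℝ ∞ η → HasCompactSupport η → ∫ x, f x * η x ∂μ = ∫ x, g x * η x ∂μ) :
    f = g :=
  Lp.ext (ae_eq_of_integral_mul_test_eq ((Lp.memLp f).locallyIntegrable one_le_two)
    ((Lp.memLp g).locallyIntegrable one_le_two) h)

end Test

/-! ### The bilinear pairing on `L²` -/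

section Pairing

variable {α : Type*} [MeasurableSpace α] {μ : Measure α}

lemma integrable_mul_of_memLp {f g : α → ℂ} (hf : MemLp f 2 μ) (hg : MemLp g 2 μ) :
    Integrable (fun x => f x * g x) μ := hf.integrable_mul hg

lemma memLp_conj {f : α → ℂ} {p : ℝ≥0∞} (hf : MemLp f p μ) : MemLp (fun x => conj (f x)) p μ :=
  (memLp_congr_norm hf.1 (Complex.continuous_conj.comp_aestronglyMeasurable hf.1)
    (ae_of_all _ fun x => by simp)).1 hf

/-- The bilinear pairing `∫ f g` on `L²`. -/
def pairingL (μ : Measure α) : Lp ℂ 2 μ →L[ℂ] Lp ℂ 2 μ →L[ℂ] ℂ :=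
  (ContinuousLinearMap.mul ℂ ℂ).lpPairing μ 2 2

lemma pairingL_apply (f g : Lp ℂ 2 μ) : pairingL μ f g = ∫ x, f x * g x ∂μ :=
  ContinuousLinearMap.lpPairing_eq_integral _ _ _

lemma pairingL_toLp (f : Lp ℂ 2 μ) {g : α → ℂ} (hg : MemLp g 2 μ) :
    pairingL μ f (hg.toLp g) = ∫ x, f x * g x ∂μ := by
  rw [pairingL_apply]
  exact integral_congr_ae (hg.coeFn_toLp.mono fun x hx => by simp [hx])

lemma norm_star_Lp (f : Lp ℂ 2 μ) : ‖star f‖ = ‖f‖ := by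
  rw [Lp.norm_def, Lp.norm_def]
  refine congrArg ENNReal.toReal (eLpNorm_congr_norm_ae ?_)
  filter_upwards [Lp.coeFn_star f] with x hx
  simp [hx]

lemma norm_pairingL_le (f g : Lp ℂ 2 μ) : ‖pairingL μ f g‖ ≤ ‖f‖ * ‖g‖ := by
  have h : pairingL μ f g = inner ℂ (star f) g := by
    rw [pairingL_apply, L2.inner_def]
    refine integral_congr_ae ?_
    filter_upwards [Lp.coeFn_star f] with x hx
    rw [hx]; simp [RCLike.inner_apply, mul_comm]
  rw [h]
  simpa [norm_star_Lp] using norm_inner_le_norm (𝕜 := ℂ) (star f) g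

lemma enorm_toLp_sq {f : α → ℂ} (hf : MemLp f 2 μ) :
    ‖hf.toLp f‖ₑ ^ 2 = ∫⁻ x, ‖f x‖ₑ ^ 2 ∂μ := by
  rw [Lp.enorm_toLp, eLpNorm_eq_lintegral_rpow_enorm_toReal two_ne_zero ENNReal.ofNat_ne_top]
  simp only [ENNReal.toReal_ofNat, ENNReal.rpow_ofNat, one_div]
  rw [← ENNReal.rpow_natCast, ← ENNReal.rpow_mul]
  simp

lemma memLp_two_iff {f : α → ℂ} (hf : AEStronglyMeasurable f μ) :
    MemLp f 2 μ ↔ ∫⁻ x, ‖f x‖ₑ ^ 2 ∂μ < ⊤ := by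
  rw [MemLp, and_iff_right hf, eLpNorm_lt_top_iff_lintegral_rpow_enorm_lt_top two_ne_zero
    ENNReal.ofNat_ne_top]
  simp

end Pairing

/-! ### The unnormalised Fourier integral -/

section Osc

variable {d : ℕ}

/-- The Fourier integral `k ↦ ∫ e^{i k·y} f(y) dy`. -/
def osc (f : Pos d → ℂ) (k : Pos d) : ℂ := ∫ y, cis (inner ℝ k y) * f y

lemma osc_eq_fourierInv (f : Pos d → ℂ) (k : Pos d) :
    osc f k = 𝓕⁻ f ((2 * Real.pi)⁻¹ • k) := by
  rw [Real.fourierInv_eq, osc]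
  congr 1 with y
  rw [Circle.smul_def, fourierChar_eq_cis, inner_smul_right, smul_eq_mul, real_inner_comm]
  congr 3
  field_simp

lemma fourierInv_eq_osc (f : Pos d → ℂ) (k : Pos d) :
    𝓕⁻ f k = osc f ((2 * Real.pi) • k) := by
  rw [osc_eq_fourierInv, smul_smul, inv_mul_cancel₀ (by positivity), one_smul]

lemma fourier_eq_osc (f : Pos d → ℂ) (k : Pos d) :
    𝓕 f k = osc f (-((2 * Real.pi) • k)) := by
  rw [← smul_neg, ← fourierInv_eq_osc, Real.fourierInv_eq_fourier_neg, neg_neg]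

lemma integral_fourierInv_mul {f g : Pos d → ℂ} (hf : Integrable f) (hg : Integrable g) :
    ∫ x, 𝓕⁻ f x * g x = ∫ x, f x * 𝓕⁻ g x := by
  have := VectorFourier.integral_fourierIntegral_smul_eq_flip (L := -innerₗ (Pos d))
    (μ := volume) (ν := volume) Real.continuous_fourierChar
    (continuous_inner (𝕜 := ℝ) (E := Pos d)).neg hf hg
  have e : (-innerₗ (Pos d)).flip = -innerₗ (Pos d) := by ext x y; simp [real_inner_comm]
  rw [e] at this
  exact this

lemma integral_osc_mul {f g : Pos d → ℂ} (hf : Integrable f) (hg : Integrable g) :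
    ∫ x, osc f x * g x = ∫ x, f x * osc g x := by
  simp only [osc, ← integral_const_mul, ← integral_mul_const]
  rw [integral_integral_swap]
  · congr 1 with x; congr 1 with y; rw [real_inner_comm]; ring
  · have : Integrable (fun p : Pos d × Pos d => g p.1 * f p.2) := hg.mul_prod hf
    refine (this.bdd_mul (c := 1) (f := fun p : Pos d × Pos d => cis (inner ℝ p.1 p.2))
      ?_ (ae_of_all _ fun p => by simp)).congr (ae_of_all _ fun p => ?_)
    · exact (by fun_prop : Continuous _).aestronglyMeasurable
    · simp only [Function.uncurry]; ring

/-- The `L²` transform is compared with the integral through test functions: on either side the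
transform can be moved onto the test function, by its compatibility with tempered distributions on
the left and by Fubini on the right. -/
lemma coeFn_fourierInv_toLp {f : Pos d → ℂ} (h1 : Integrable f) (h2 : MemLp f 2) :
    (𝓕⁻ (h2.toLp f) : WaveSpace d) =ᵐ[volume] 𝓕⁻ f := by
  have hc : Continuous (𝓕⁻ f) := by
    exact VectorFourier.fourierIntegral_continuous Real.continuous_fourierChar
      (continuous_inner (𝕜 := ℝ) (E := Pos d)).neg h1
  refine ae_eq_of_integral_mul_test_eq ((Lp.memLp _).locallyIntegrable one_le_two)
    hc.locallyIntegrable fun η hη hs => ?_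
  set g : SchwartzMap (Pos d) ℂ := hs.toSchwartzMap hη
  have h3 := congrArg (fun u => u g) (Lp.fourierInv_toTemperedDistribution_eq (h2.toLp f))
  simp only [TemperedDistribution.fourierInv_apply, Lp.toTemperedDistribution_apply,
    smul_eq_mul] at h3
  have hg : ∀ x, g x = η x := fun x => rfl
  simp only [← hg]
  rw [integral_fourierInv_mul h1 g.integrable]
  simp only [mul_comm _ (g _)]
  rw [← h3, SchwartzMap.fourierInv_coe]
  refine integral_congr_ae (h2.coeFn_toLp.mono fun x hx => ?_)
  simp [hx, mul_comm]

lemma memLp_fourierInv {f : Pos d → ℂ} (h1 : Integrable f) (h2 : MemLp f 2) :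
    MemLp (𝓕⁻ f) 2 volume :=
  (memLp_congr_ae (coeFn_fourierInv_toLp h1 h2)).1 (Lp.memLp _)

lemma toLp_fourierInv {f : Pos d → ℂ} (h1 : Integrable f) (h2 : MemLp f 2) :
    (memLp_fourierInv h1 h2).toLp = 𝓕⁻ (h2.toLp f) :=
  Lp.ext ((memLp_fourierInv h1 h2).coeFn_toLp.trans (coeFn_fourierInv_toLp h1 h2).symm)

lemma lintegral_comp_smul {r : ℝ} (hr : 0 < r) {f : Pos d → ℝ≥0∞} (hf : AEMeasurable f) :
    ∫⁻ x, f (r • x) = ENNReal.ofReal ((r ^ d)⁻¹) * ∫⁻ x, f x := by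
  have h := Measure.map_addHaar_smul (volume : Measure (Pos d)) hr.ne'
  rw [abs_of_pos (by positivity), finrank_euclideanSpace_fin] at h
  rw [← smul_eq_mul, ← lintegral_smul_measure, ← h, lintegral_map' _ (by fun_prop)]
  rw [h]; exact hf.smul_measure _

lemma integral_comp_smul' {r : ℝ} (hr : 0 < r) (f : Pos d → ℂ) :
    ∫ x, f (r • x) = ((r : ℂ) ^ d)⁻¹ * ∫ x, f x := by
  rw [Measure.integral_comp_smul, abs_of_pos (by positivity), finrank_euclideanSpace_fin]
  simp [Complex.real_smul]

lemma memLp_comp_smul {r : ℝ} (hr : 0 < r) {f : Pos d → ℂ} (hf : MemLp f 2) :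
    MemLp (fun x => f (r • x)) 2 := by
  have h := Measure.map_addHaar_smul (volume : Measure (Pos d)) hr.ne'
  have : MemLp f 2 (Measure.map (fun x => r • x) volume) := by
    rw [h]; exact hf.smul_measure ENNReal.ofReal_ne_top
  exact this.comp_of_map (by fun_prop)

lemma memLp_osc {f : Pos d → ℂ} (h1 : Integrable f) (h2 : MemLp f 2) : MemLp (osc f) 2 := by
  rw [show osc f = fun k => 𝓕⁻ f ((2 * Real.pi)⁻¹ • k) from funext (osc_eq_fourierInv f)]
  exact memLp_comp_smul (by positivity) (memLp_fourierInv h1 h2)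

/-- **Plancherel's theorem** for the unnormalised Fourier integral. -/
lemma lintegral_osc {f : Pos d → ℂ} (h1 : Integrable f) (h2 : MemLp f 2) :
    ∫⁻ k, ‖osc f k‖ₑ ^ 2 = ENNReal.ofReal ((2 * Real.pi) ^ d) * ∫⁻ y, ‖f y‖ₑ ^ 2 := by
  simp only [osc_eq_fourierInv]
  have h3 := memLp_fourierInv h1 h2
  rw [lintegral_comp_smul (f := fun k => ‖𝓕⁻ f k‖ₑ ^ 2) (by positivity) (h3.1.enorm.pow_const 2)]
  rw [← enorm_toLp_sq h3, ← enorm_toLp_sq h2, toLp_fourierInv h1 h2]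
  congr 2
  · rw [inv_pow, inv_inv]
  · have := (Lp.fourierTransformₗᵢ (Pos d) ℂ).symm.norm_map (h2.toLp f)
    rw [← ofReal_norm, ← ofReal_norm, ← this]; rfl

/-- **Parseval's theorem** for the unnormalised Fourier integral. -/
lemma integral_conj_osc_mul_osc {f g : Pos d → ℂ} (hf1 : Integrable f) (hf2 : MemLp f 2)
    (hg1 : Integrable g) (hg2 : MemLp g 2) :
    ∫ k, conj (osc f k) * osc g k = (2 * Real.pi : ℂ) ^ d * ∫ y, conj (f y) * g y := by
  simp only [osc_eq_fourierInv]
  have h3 := memLp_fourierInv hf1 hf2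
  have h4 := memLp_fourierInv hg1 hg2
  have key : ∀ {u v : Pos d → ℂ} (hu : MemLp u 2) (hv : MemLp v 2),
      ∫ y, conj (u y) * v y = inner ℂ (hu.toLp u) (hv.toLp v) := by
    intro u v hu hv
    rw [L2.inner_def]
    refine integral_congr_ae ?_
    filter_upwards [hu.coeFn_toLp, hv.coeFn_toLp] with x h1 h2
    rw [h1, h2]; simp [RCLike.inner_apply, mul_comm]
  rw [integral_comp_smul' (f := fun k => conj (𝓕⁻ f k) * 𝓕⁻ g k) (by positivity), key h3 h4,
    key hf2 hg2, toLp_fourierInv hf1 hf2, toLp_fourierInv hg1 hg2]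
  congr 1
  · push_cast; rw [inv_pow, inv_inv]
  · exact (Lp.fourierTransformₗᵢ (Pos d) ℂ).symm.inner_map_map _ _

/-- **Fourier inversion** for Schwartz functions. -/
lemma osc_osc (χ : SchwartzMap (Pos d) ℂ) (k : Pos d) :
    osc (fun y => osc χ (-y)) k = (2 * Real.pi : ℂ) ^ d * χ k := by
  have h : ∀ y, osc χ (-y) = 𝓕 χ ((2 * Real.pi)⁻¹ • y) := by
    intro y
    rw [SchwartzMap.fourier_coe, fourier_eq_osc, smul_smul, mul_inv_cancel₀ (by positivity),
      one_smul]
  have h2 : ∀ k, 𝓕⁻ (𝓕 χ) k = χ k := fun k => by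
    rw [FourierTransform.fourierInv_fourier_eq]
  rw [← h2, SchwartzMap.fourierInv_coe, fourierInv_eq_osc, osc, osc]
  have := integral_comp_smul' (d := d) (r := (2 * Real.pi)⁻¹) (by positivity)
    (fun y => cis (inner ℝ ((2 * Real.pi) • k) y) * 𝓕 χ y)
  simp only [inner_smul_right, inner_smul_left] at this
  simp only [h]
  convert this using 1
  · congr 1 with y; congr 2; simp; field_simp
  · push_cast; simp only [inv_pow, inv_inv, inner_smul_left]

end Osc

/-! ### Weak evolution equations in `L²` -/

section Evolution

variable {α : Type*} [MeasurableSpace α] {μ : Measure α}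

/-- The product rule for `∫ f(τ) c(τ)` where `f` is continuous with values in `L²` and weakly
differentiable against `c(t)`, while `c` is differentiable pointwise with an `L²` bound. -/
lemma hasDerivWithinAt_integral_mul {f : ℝ → Lp ℂ 2 μ} {c c' : ℝ → α → ℂ} {G : α → ℝ}
    {s : Set ℝ} {t : ℝ} {D : ℂ} (hs : Convex ℝ s) (ht : t ∈ s) (hf : ContinuousWithinAt f s t)
    (hc : ∀ τ, MemLp (c τ) 2 μ)
    (hc' : ∀ τ ∈ s, ∀ x, HasDerivAt (fun τ => c τ x) (c' τ x) τ)
    (hG : MemLp G 2 μ) (hb : ∀ τ ∈ s, ∀ x, ‖c' τ x‖ ≤ G x)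
    (hD : HasDerivWithinAt (fun τ => ∫ x, f τ x * c t x ∂μ) D s t) :
    HasDerivWithinAt (fun τ => ∫ x, f τ x * c τ x ∂μ) (D + ∫ x, f t x * c' t x ∂μ) s t := by
  rw [hasDerivWithinAt_iff_tendsto_slope] at hD ⊢
  set q : ℝ → α → ℂ := fun τ x => (τ - t)⁻¹ • (c τ x - c t x) with hq
  have hqm : ∀ τ, MemLp (q τ) 2 μ := fun τ => ((hc τ).sub (hc t)).const_smul (τ - t)⁻¹
  have hqb : ∀ τ ∈ s, ∀ x, ‖q τ x‖ ≤ G x := by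
    intro τ hτ x
    have h1 : ‖c τ x - c t x‖ ≤ G x * ‖τ - t‖ :=
      hs.norm_image_sub_le_of_norm_hasDerivWithin_le
        (fun y hy => (hc' y hy x).hasDerivWithinAt) (fun y hy => hb y hy x) ht hτ
    rcases eq_or_ne τ t with rfl | hne
    · simpa [hq] using (norm_nonneg _).trans (hb τ hτ x)
    · rw [hq, norm_smul, norm_inv, inv_mul_le_iff₀ (norm_pos_iff.2 (sub_ne_zero.2 hne)), mul_comm]
      exact h1
  have hqn : ∀ τ ∈ s, ‖(hqm τ).toLp‖ ≤ ‖hG.toLp‖ := by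
    intro τ hτ
    refine Lp.norm_le_norm_of_ae_le ?_
    filter_upwards [(hqm τ).coeFn_toLp, hG.coeFn_toLp] with x h1 h2
    rw [h1, h2]
    exact (hqb τ hτ x).trans (le_abs_self _)
  have hmem : ∀ᶠ τ in 𝓝[s \ {t}] t, τ ∈ s := by
    filter_upwards [self_mem_nhdsWithin] with τ hτ using hτ.1
  have key : Tendsto (fun τ => ∫ x, f t x * q τ x ∂μ) (𝓝[s \ {t}] t)
      (𝓝 (∫ x, f t x * c' t x ∂μ)) := by
    refine tendsto_integral_filter_of_dominated_convergence (fun x => ‖f t x‖ * G x) ?_ ?_ ?_ ?_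
    · exact Eventually.of_forall fun τ => (Lp.memLp (f t)).1.mul (hqm τ).1
    · filter_upwards [hmem] with τ hτ
      refine ae_of_all _ fun x => ?_
      rw [norm_mul]
      exact mul_le_mul_of_nonneg_left (hqb τ hτ x) (norm_nonneg _)
    · exact (Lp.memLp (f t)).norm.integrable_mul hG
    · refine ae_of_all _ fun x => Tendsto.const_mul _ ?_
      have := (hc' t ht x).hasDerivWithinAt (s := s)
      rw [hasDerivWithinAt_iff_tendsto_slope] at this
      exact this
  have key2 : Tendsto (fun τ => pairingL μ (f τ - f t) (hqm τ).toLp) (𝓝[s \ {t}] t) (𝓝 0) := by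
    have h0 : Tendsto (fun τ => ‖f τ - f t‖ * ‖hG.toLp‖) (𝓝[s \ {t}] t) (𝓝 0) := by
      have h1 : Tendsto (fun τ => f τ - f t) (𝓝[s \ {t}] t) (𝓝 (f t - f t)) :=
        Tendsto.sub_const (hf.mono_left (nhdsWithin_mono _ Set.sdiff_subset)) _
      simpa using h1.norm.mul_const ‖hG.toLp‖
    refine squeeze_zero_norm' ?_ h0
    filter_upwards [hmem] with τ hτ
    exact (norm_pairingL_le _ _).trans
      (mul_le_mul_of_nonneg_left (hqn τ hτ) (norm_nonneg _))
  -- The slope of `∫ f c` splits into the slope of `f` against the frozen `c t`, the term `∫ (f τ -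
  -- f t) q τ` which vanishes by continuity of `f` and the uniform `L²` bound on `q`, and `∫ f t · q
  -- τ` which converges by domination.
  have := (hD.add key2).add key
  rw [add_zero] at this
  refine this.congr' ?_
  filter_upwards [self_mem_nhdsWithin] with τ hτ
  rw [map_sub, sub_apply, pairingL_toLp, pairingL_toLp, add_assoc, sub_add_cancel]
  simp only [slope_def_module]
  have hi : ∀ σ, Integrable (fun x => f τ x * c σ x) μ := fun σ =>
    integrable_mul_of_memLp (Lp.memLp _) (hc σ)
  have : ∫ x, f τ x * q τ x ∂μ
      = (τ - t)⁻¹ • (∫ x, f τ x * c τ x ∂μ - ∫ x, f τ x * c t x ∂μ) := by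
    rw [← integral_sub (hi _) (hi _), ← integral_smul]
    congr 1 with x
    simp only [hq, Complex.real_smul]; ring
  rw [this, ← smul_add]
  congr 1; ring

/-- A curve in `L²` which is weakly differentiable with a continuous derivative is differentiable
in norm. -/
lemma hasDerivWithinAt_of_weak {E : Type*} [NormedAddCommGroup E] [NormedSpace ℝ E]
    [FiniteDimensional ℝ E] [MeasurableSpace E] [BorelSpace E] {μ : Measure E}
    [IsLocallyFiniteMeasure μ] {b r : ℝ → Lp ℂ 2 μ} {T : ℝ} (hT : 0 < T)
    (hr : ContinuousOn r (Set.Icc 0 T))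
    (h : ∀ η : E → ℂ, ContDiff ℝ ∞ η → HasCompactSupport η → ∀ t ∈ Set.Icc 0 T,
      HasDerivWithinAt (fun s => ∫ x, b s x * η x ∂μ) (∫ x, r t x * η x ∂μ) (Set.Icc 0 T) t) :
    ∀ t ∈ Set.Icc 0 T, HasDerivWithinAt b (r t) (Set.Icc 0 T) t := by
  -- Extending `r` by its endpoint values makes it continuous on all of `ℝ`, so it has a primitive
  -- `β` in norm. Against each test function `b - β` has derivative zero, whence `b = β` on `[0,
  -- T]`.
  set ρ : ℝ → Lp ℂ 2 μ := fun s => r (Set.projIcc 0 T hT.le s) with hρ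
  have hρc : Continuous ρ := by
    have := (continuousOn_iff_continuous_domRestrict.1 hr).comp (continuous_projIcc (h := hT.le))
    exact this
  have hρr : ∀ t ∈ Set.Icc 0 T, ρ t = r t := fun t ht => by simp [hρ, Set.projIcc_of_mem _ ht]
  set β : ℝ → Lp ℂ 2 μ := fun t => b 0 + ∫ s in (0 : ℝ)..t, ρ s with hβ
  have hβd : ∀ t, HasDerivAt β (ρ t) t := fun t =>
    ((hρc.integral_hasStrictDerivAt 0 t).hasDerivAt).const_add _
  have hbβ : ∀ t ∈ Set.Icc 0 T, b t = β t := by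
    intro t ht
    refine Lp_eq_of_integral_mul_test_eq fun η hη hs => ?_
    have hηL : MemLp η 2 μ := hη.continuous.memLp_of_hasCompactSupport hs
    have h1 : ∀ s ∈ Set.Icc 0 T, HasDerivWithinAt
        (fun s => (∫ x, b s x * η x ∂μ) - ∫ x, β s x * η x ∂μ) 0 (Set.Icc 0 T) s := by
      intro s hs'
      have h2 := h η hη hs s hs'
      have h3 : HasDerivWithinAt (fun s => ∫ x, β s x * η x ∂μ) (∫ x, r s x * η x ∂μ)
          (Set.Icc 0 T) s := by
        simp only [← pairingL_toLp _ hηL]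
        rw [← hρr s hs']
        exact (((pairingL μ).flip hηL.toLp).hasFDerivAt.restrictScalars ℝ).comp_hasDerivWithinAt s
          (hβd s).hasDerivWithinAt
      have h6 := h2.sub h3
      rw [sub_self] at h6
      exact h6
    have h4 := constant_of_has_deriv_right_zero (fun s hs' => (h1 s hs').continuousWithinAt)
      (fun s hs' => ((h1 s ⟨hs'.1, hs'.2.le⟩).mono_of_mem_nhdsWithin
        (Icc_mem_nhdsGE_of_mem hs'))) t ht
    have h5 : β 0 = b 0 := by simp [hβ]
    rw [h5, sub_self] at h4
    exact sub_eq_zero.1 h4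
  intro t ht
  rw [← hρr t ht]
  exact (hβd t).hasDerivWithinAt.congr hbβ (hbβ t ht)

/-- A Grönwall argument for a curve `h` whose norm is controlled by scalar functions `p i`. -/
lemma eq_zero_of_weak_gronwall {H ι : Type*} [NormedAddCommGroup H] {h : ℝ → H} {T C : ℝ}
    (hT : 0 < T) (hC : 0 ≤ C) (hh : ContinuousOn h (Set.Icc 0 T)) {p p' : ι → ℝ → ℂ} {N : ι → ℝ}
    (hp : ∀ i, ∀ t ∈ Set.Icc 0 T, HasDerivWithinAt (p i) (p' i t) (Set.Icc 0 T) t)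
    (hp' : ∀ i, ∀ t ∈ Set.Icc 0 T, ‖p' i t‖ ≤ C * N i * ‖h t‖)
    (hd : ∀ t ∈ Set.Icc 0 T, ∀ M, 0 ≤ M → (∀ i, ‖p i t‖ ≤ M * N i) → ‖h t‖ ≤ M)
    (h0 : ∀ i, p i 0 = 0) : ∀ t ∈ Set.Icc 0 T, h t = 0 := by
  set y : ℝ → ℝ := fun s => ‖h (Set.projIcc 0 T hT.le s)‖ with hy
  have hyc : Continuous y :=
    ((continuousOn_iff_continuous_domRestrict.1 hh).comp (continuous_projIcc (h := hT.le))).norm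
  have hyh : ∀ t ∈ Set.Icc 0 T, y t = ‖h t‖ := fun t ht => by simp [hy, Set.projIcc_of_mem _ ht]
  set Y : ℝ → ℝ := fun t => ∫ s in (0 : ℝ)..t, y s with hY
  have hYd : ∀ t, HasDerivAt Y (y t) t := fun t =>
    (hyc.integral_hasStrictDerivAt 0 t).hasDerivAt
  have hY0 : ∀ t, 0 ≤ t → 0 ≤ Y t := fun t ht =>
    intervalIntegral.integral_nonneg ht fun s _ => norm_nonneg _
  have h1 : ∀ i, ∀ t ∈ Set.Icc 0 T, ‖p i t‖ ≤ C * N i * Y t := by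
    intro i t ht
    refine image_norm_le_of_norm_deriv_right_le_deriv_boundary (f' := p' i)
      (B := fun t => C * N i * Y t) (B' := fun t => C * N i * y t)
      (fun s hs => (hp i s hs).continuousWithinAt)
      (fun s hs => (hp i s ⟨hs.1, hs.2.le⟩).mono_of_mem_nhdsWithin (Icc_mem_nhdsGE_of_mem hs))
      (by simp [h0, hY]) (fun s => (hYd s).const_mul _) (fun s hs => ?_) ht
    rw [hyh s ⟨hs.1, hs.2.le⟩]
    exact hp' i s ⟨hs.1, hs.2.le⟩
  -- The bounds on all `p i` are converted by duality into one on `‖h‖ = Y'`, which closes the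
  -- inequality `Y' ≤ C Y` with `Y 0 = 0`.
  have h2 : ∀ t ∈ Set.Icc 0 T, ‖h t‖ ≤ C * Y t := fun t ht =>
    hd t ht _ (mul_nonneg hC (hY0 t ht.1)) fun i => (h1 i t ht).trans_eq (by ring)
  have h3 : ∀ t ∈ Set.Icc 0 T, ‖Y t‖ ≤ gronwallBound 0 C 0 (t - 0) :=
    norm_le_gronwallBound_of_norm_deriv_right_le (f' := y)
      (fun s _ => (hYd s).continuousAt.continuousWithinAt)
      (fun s _ => (hYd s).hasDerivWithinAt) (by simp [hY]) fun s hs => by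
        have hs' : s ∈ Set.Icc 0 T := ⟨hs.1, hs.2.le⟩
        rw [hyh s hs', norm_norm, Real.norm_of_nonneg (hY0 s hs.1), add_zero]
        exact h2 s hs'
  intro t ht
  have h4 := h3 t ht
  rw [gronwallBound_ε0_δ0, norm_le_zero_iff] at h4
  simpa [h4] using h2 t ht

/-- Time reversal `t ↦ T - t` only changes the sign of the derivatives, and the hypotheses see their
norms. -/
lemma eq_zero_of_weak_gronwall_final {H ι : Type*} [NormedAddCommGroup H] {h : ℝ → H} {T C : ℝ}
    (hT : 0 < T) (hC : 0 ≤ C) (hh : ContinuousOn h (Set.Icc 0 T)) {p p' : ι → ℝ → ℂ} {N : ι → ℝ}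
    (hp : ∀ i, ∀ t ∈ Set.Icc 0 T, HasDerivWithinAt (p i) (p' i t) (Set.Icc 0 T) t)
    (hp' : ∀ i, ∀ t ∈ Set.Icc 0 T, ‖p' i t‖ ≤ C * N i * ‖h t‖)
    (hd : ∀ t ∈ Set.Icc 0 T, ∀ M, 0 ≤ M → (∀ i, ‖p i t‖ ≤ M * N i) → ‖h t‖ ≤ M)
    (h0 : ∀ i, p i T = 0) : ∀ t ∈ Set.Icc 0 T, h t = 0 := by
  have hm : Set.MapsTo (fun t => T - t) (Set.Icc 0 T) (Set.Icc 0 T) := fun t ht =>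
    ⟨by linarith [ht.2], by linarith [ht.1]⟩
  have := eq_zero_of_weak_gronwall (h := fun t => h (T - t)) (p := fun i t => p i (T - t))
    (p' := fun i t => -p' i (T - t)) (N := N) hT hC
    (hh.comp (by fun_prop) hm)
    (fun i t ht => by
      have h1 : HasDerivWithinAt (fun t => T - t) (-1) (Set.Icc 0 T) t := by
        simpa using (hasDerivWithinAt_id t _).const_sub T
      have h2 := (hp i _ (hm ht)).scomp t h1 hm
      rw [neg_smul, one_smul] at h2
      exact h2)
    (fun i t ht => by rw [norm_neg]; exact hp' i _ (hm ht))
    (fun t ht M hM h => hd _ (hm ht) M hM h) (fun i => by simp [h0])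
  intro t ht
  simpa using this _ (hm ht)

end Evolution

/-! ### Multiplication operators -/

section MulOp

variable {α : Type*} [MeasurableSpace α] {μ : Measure α}

/-- Multiplication by a bounded function, as an operator on `L²`. -/
def mulOp {m : α → ℂ} (hm : MemLp m ⊤ μ) : Lp ℂ 2 μ →L[ℂ] Lp ℂ 2 μ :=
  (ContinuousLinearMap.mul ℂ ℂ).holderL μ ⊤ 2 2 hm.toLp

lemma coeFn_mulOp {m : α → ℂ} (hm : MemLp m ⊤ μ) (f : Lp ℂ 2 μ) :
    mulOp hm f =ᵐ[μ] fun x => m x * f x := by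
  filter_upwards [(ContinuousLinearMap.mul ℂ ℂ).coeFn_holder (r := 2) hm.toLp f, hm.coeFn_toLp]
    with x h1 h2
  rw [← h2]; exact h1

lemma integral_mulOp_mul {m : α → ℂ} (hm : MemLp m ⊤ μ) (f : Lp ℂ 2 μ) (g : α → ℂ) :
    ∫ x, mulOp hm f x * g x ∂μ = ∫ x, f x * (m x * g x) ∂μ :=
  integral_congr_ae ((coeFn_mulOp hm f).mono fun x hx => by simp only [hx]; ring)

lemma inner_mulOp_mulOp {m : α → ℂ} (hm : MemLp m ⊤ μ) (h1 : ∀ x, ‖m x‖ = 1) (f g : Lp ℂ 2 μ) :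
    inner ℂ (mulOp hm f) (mulOp hm g) = inner ℂ f g := by
  rw [L2.inner_def, L2.inner_def]
  refine integral_congr_ae ?_
  filter_upwards [coeFn_mulOp hm f, coeFn_mulOp hm g] with x h2 h3
  rw [h2, h3]
  simp only [RCLike.inner_apply, map_mul]
  have := Complex.mul_conj (m x)
  rw [Complex.normSq_eq_norm_sq, h1] at this
  push_cast at this
  linear_combination (g x * conj (f x)) * this

lemma norm_mulOp {m : α → ℂ} (hm : MemLp m ⊤ μ) (h1 : ∀ x, ‖m x‖ = 1) (f : Lp ℂ 2 μ) :
    ‖mulOp hm f‖ = ‖f‖ := by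
  have := inner_mulOp_mulOp hm h1 f f
  rw [inner_self_eq_norm_sq_to_K, inner_self_eq_norm_sq_to_K] at this
  have h : ‖mulOp hm f‖ ^ 2 = ‖f‖ ^ 2 := by exact_mod_cast this
  exact (pow_left_inj₀ (norm_nonneg _) (norm_nonneg _) two_ne_zero).1 h

lemma norm_sq_eq_integral (f : Lp ℂ 2 μ) : ‖f‖ ^ 2 = ∫ x, ‖f x‖ ^ 2 ∂μ := by
  rw [← inner_self_eq_norm_sq (𝕜 := ℂ), L2.inner_def, ← integral_re (L2.integrable_inner f f)]
  simp only [inner_self_eq_norm_sq]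

/-- The multipliers need not be continuous in operator norm, only strongly. For a fixed vector this
is dominated convergence; the variation of `u` is controlled because each multiplier is an isometry.
-/
lemma continuousOn_mulOp {m : ℝ → α → ℂ} (hm : ∀ t, MemLp (m t) ⊤ μ) (h1 : ∀ t x, ‖m t x‖ = 1)
    (hc : ∀ x, Continuous fun t => m t x) {u : ℝ → Lp ℂ 2 μ} {s : Set ℝ} (hu : ContinuousOn u s) :
    ContinuousOn (fun t => mulOp (hm t) (u t)) s := by
  intro t ht
  have h2 : Tendsto (fun τ => ‖mulOp (hm τ) (u t) - mulOp (hm t) (u t)‖ ^ 2) (𝓝[s] t) (𝓝 0) := by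
    have h3 : ∀ τ, ‖mulOp (hm τ) (u t) - mulOp (hm t) (u t)‖ ^ 2 =
        ∫ x, ‖(m τ x - m t x) * u t x‖ ^ 2 ∂μ := by
      intro τ
      rw [norm_sq_eq_integral]
      refine integral_congr_ae ?_
      filter_upwards [coeFn_mulOp (hm τ) (u t), coeFn_mulOp (hm t) (u t),
        Lp.coeFn_sub (mulOp (hm τ) (u t)) (mulOp (hm t) (u t))] with x h4 h5 h6
      rw [h6, Pi.sub_apply, h4, h5, sub_mul]
    simp only [h3]
    have h7 : ∫ x, ‖(m t x - m t x) * u t x‖ ^ 2 ∂μ = 0 := by simp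
    rw [← h7]
    refine tendsto_integral_filter_of_dominated_convergence (fun x => 4 * ‖u t x‖ ^ 2) ?_ ?_ ?_ ?_
    · exact Eventually.of_forall fun τ =>
        (((hm τ).1.sub (hm t).1).mul (Lp.memLp (u t)).1).norm.pow 2
    · refine Eventually.of_forall fun τ => ae_of_all _ fun x => ?_
      have h8 : ‖m τ x - m t x‖ ≤ 2 := (norm_sub_le _ _).trans (by rw [h1, h1]; norm_num)
      rw [norm_pow, norm_norm, norm_mul, mul_pow]
      refine mul_le_mul_of_nonneg_right ?_ (sq_nonneg _)
      nlinarith [norm_nonneg (m τ x - m t x)]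
    · exact ((Lp.memLp (u t)).norm.integrable_sq).const_mul 4
    · refine ae_of_all _ fun x => ?_
      have : Continuous fun τ => ‖(m τ x - m t x) * u t x‖ ^ 2 := by
        have := hc x; fun_prop
      exact (this.tendsto t).mono_left nhdsWithin_le_nhds
  have h3 : Tendsto (fun τ => mulOp (hm τ) (u t)) (𝓝[s] t) (𝓝 (mulOp (hm t) (u t))) := by
    rw [tendsto_iff_norm_sub_tendsto_zero]
    have := h2.sqrt
    simpa [Real.sqrt_sq] using this
  have h4 : Tendsto (fun τ => mulOp (hm τ) (u τ - u t)) (𝓝[s] t) (𝓝 0) := by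
    rw [tendsto_zero_iff_norm_tendsto_zero]
    simp only [norm_mulOp _ (h1 _)]
    exact tendsto_iff_norm_sub_tendsto_zero.1 (hu t ht)
  simpa [ContinuousWithinAt] using h4.add h3

end MulOp

/-! ### The Schrödinger equation in the interaction picture -/

section Schrodinger

variable {d : ℕ}

lemma integral_fourier_mul_schwartz (φ : WaveSpace d) (η : SchwartzMap (Pos d) ℂ) :
    ∫ x, (𝓕 φ : WaveSpace d) x * η x = ∫ x, φ x * (𝓕 η : SchwartzMap (Pos d) ℂ) x := by
  have h := congrArg (fun u => u η) (Lp.fourier_toTemperedDistribution_eq φ)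
  simp only [TemperedDistribution.fourier_apply, Lp.toTemperedDistribution_apply,
    smul_eq_mul] at h
  simp only [mul_comm _ (η _), mul_comm (φ _) _]
  exact h.symm

/-- In the weak equation the Laplacian falls on the transform of a test function; writing it as a
sum of second derivatives along an orthonormal basis turns it into multiplication on the frequency
side. -/
lemma laplacian_fourier (η : SchwartzMap (Pos d) ℂ) :
    Laplacian.laplacian (𝓕 η) = -((2 * Real.pi) ^ 2 : ℝ) •
      𝓕 (SchwartzMap.smulLeftCLM ℂ (fun x : Pos d => ‖x‖ ^ 2) η) := by
  have hi : ∀ m : Pos d, (fun x : Pos d => inner ℝ x m).HasTemperateGrowth := fun m => by fun_prop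
  let b := stdOrthonormalBasis ℝ (Pos d)
  rw [SchwartzMap.laplacian_eq_sum b]
  simp only [SchwartzMap.lineDerivOp_fourier_eq]
  change ∑ i, fourierCLM ℂ (SchwartzMap (Pos d) ℂ) _ =
    _ • fourierCLM ℂ (SchwartzMap (Pos d) ℂ) _
  rw [← map_sum, ← (fourierCLM ℂ (SchwartzMap (Pos d) ℂ)).map_smul_of_tower]
  congr 1
  ext x
  rw [sum_apply, smul_apply, SchwartzMap.smulLeftCLM_apply_apply (by fun_prop),
    ← b.sum_sq_inner_left, Finset.sum_smul, Finset.smul_sum]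
  refine Finset.sum_congr rfl fun i _ => ?_
  rw [smul_apply, SchwartzMap.smulLeftCLM_apply_apply (hi _), smul_apply,
    SchwartzMap.smulLeftCLM_apply_apply (hi _)]
  simp only [Complex.real_smul, smul_eq_mul]
  push_cast
  linear_combination (4 * Real.pi ^ 2 * (inner ℝ x (b i) : ℝ) ^ 2 * η x : ℂ) * Complex.I_sq

/-- The phase by which the free Schrödinger flow is undone on the Fourier side. -/
def freePhase (ε t : ℝ) (ξ : Pos d) : ℂ := cis (t * (2 * Real.pi ^ 2 * ε * ‖ξ‖ ^ 2))

@[simp] lemma norm_freePhase (ε t : ℝ) (ξ : Pos d) : ‖freePhase ε t ξ‖ = 1 := norm_cis _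

lemma contDiff_cis : ContDiff ℝ ∞ cis := by
  have : cis = fun θ : ℝ => Complex.exp (Complex.I * Complex.ofRealCLM θ) := rfl
  rw [this]; fun_prop

lemma contDiff_freePhase (ε t : ℝ) : ContDiff ℝ ∞ (freePhase (d := d) ε t) :=
  contDiff_cis.comp (contDiff_const.mul (contDiff_const.mul (contDiff_norm_sq ℝ)))

lemma memLp_freePhase (ε t : ℝ) : MemLp (freePhase (d := d) ε t) ⊤ volume :=
  memLp_top_of_bound (contDiff_freePhase ε t).continuous.aestronglyMeasurable 1
    (ae_of_all _ fun x => by simp)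

/-- With the kernel `e^{-2πi x·ξ}` the symbol of `-(ε/2) Δ` is `2π² ε ‖ξ‖²`, so this derivative is
what cancels the kinetic term. -/
lemma hasDerivAt_freePhase (ε t : ℝ) (ξ : Pos d) :
    HasDerivAt (fun t => freePhase ε t ξ)
      (Complex.I * (2 * Real.pi ^ 2 * ε * ‖ξ‖ ^ 2) * freePhase ε t ξ) t := by
  have h : HasDerivAt (fun t : ℝ => Complex.I * ((t * (2 * Real.pi ^ 2 * ε * ‖ξ‖ ^ 2) : ℝ) : ℂ))
      (Complex.I * ((2 * Real.pi ^ 2 * ε * ‖ξ‖ ^ 2 : ℝ) : ℂ)) t := by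
    have := (((hasDerivAt_id t).mul_const (2 * Real.pi ^ 2 * ε * ‖ξ‖ ^ 2)).ofReal_comp).const_mul
      Complex.I
    simpa using this
  have := h.cexp
  unfold freePhase cis
  convert this using 1
  push_cast; ring

/-- The backward free Schrödinger flow `e^{-i t ε Δ / 2}` on `L²`. -/
def backFlow (ε t : ℝ) : WaveSpace d →L[ℂ] WaveSpace d :=
  fourierInvCLM ℂ (WaveSpace d) ∘L mulOp (memLp_freePhase ε t) ∘L fourierCLM ℂ (WaveSpace d)

lemma backFlow_apply (ε t : ℝ) (φ : WaveSpace d) :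
    backFlow ε t φ = 𝓕⁻ (mulOp (memLp_freePhase ε t) (𝓕 φ)) := rfl

lemma fourier_backFlow (ε t : ℝ) (φ : WaveSpace d) :
    𝓕 (backFlow ε t φ) = mulOp (memLp_freePhase ε t) (𝓕 φ) := by
  rw [backFlow_apply, FourierTransform.fourier_fourierInv_eq]

lemma inner_backFlow (ε t : ℝ) (φ ψ : WaveSpace d) :
    inner ℂ (backFlow ε t φ) (backFlow ε t ψ) = inner ℂ φ ψ := by
  rw [← Lp.inner_fourier_eq, fourier_backFlow, fourier_backFlow,
    inner_mulOp_mulOp _ (norm_freePhase ε t), Lp.inner_fourier_eq]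

/-- The potential as an element of `L^∞`. -/
lemma memLp_potential (V : Pos d →ᵇ ℝ) : MemLp (fun x => (V x : ℂ)) ⊤ volume :=
  memLp_top_of_bound (by fun_prop : Continuous fun x => (V x : ℂ)).aestronglyMeasurable ‖V‖
    (ae_of_all _ fun x => by simpa using V.norm_coe_le_norm x)

/-- The generator `(i ε)⁻¹ V` of the Schrödinger equation in the interaction picture. -/
def potentialGen (ε : ℝ) (V : Pos d →ᵇ ℝ) : WaveSpace d →L[ℂ] WaveSpace d :=
  (1 / (Complex.I * ε)) • mulOp (memLp_potential V)

lemma coeFn_potentialGen (ε : ℝ) (V : Pos d →ᵇ ℝ) (φ : WaveSpace d) :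
    potentialGen ε V φ =ᵐ[volume] fun x => 1 / (Complex.I * ε) * (V x * φ x) := by
  filter_upwards [coeFn_mulOp (memLp_potential V) φ,
    Lp.coeFn_smul (1 / (Complex.I * ε) : ℂ) (mulOp (memLp_potential V) φ)] with x h1 h2
  rw [potentialGen, smul_apply, h2, Pi.smul_apply, h1, smul_eq_mul]

/-- In the interaction picture a weak solution of the Schrödinger equation is differentiable in
`L²`. -/
lemma IsSchrodingerSolution.hasDerivWithinAt {ε T : ℝ} (hε : 0 < ε) (hT : 0 < T) {V : Pos d →ᵇ ℝ}
    {φ : ℝ → WaveSpace d} (h : IsSchrodingerSolution ε T V φ) :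
    ∀ t ∈ Set.Icc 0 T, HasDerivWithinAt (fun s => backFlow ε s (φ s))
      (backFlow ε t (potentialGen ε V (φ t))) (Set.Icc 0 T) t := by
  have hF : ∀ u : ℝ → WaveSpace d, ContinuousOn u (Set.Icc 0 T) →
      ContinuousOn (fun t => 𝓕 (u t)) (Set.Icc 0 T) := fun u hu =>
    (fourierCLM ℂ (WaveSpace d)).continuous.comp_continuousOn hu
  have hcM : ∀ u : ℝ → WaveSpace d, ContinuousOn u (Set.Icc 0 T) →
      ContinuousOn (fun t => mulOp (memLp_freePhase ε t) (u t)) (Set.Icc 0 T) := fun u hu =>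
    continuousOn_mulOp _ (norm_freePhase ε) (fun ξ => by unfold freePhase; fun_prop) hu
  -- The equation is tested on the frequency side. For a compactly supported `η` the product
  -- `freePhase ε t * η` is again a test function, and the unbounded factor `‖ξ‖²` is harmless on
  -- its support.
  have key := hasDerivWithinAt_of_weak hT
    (b := fun s => mulOp (memLp_freePhase ε s) (𝓕 (φ s)))
    (r := fun t => mulOp (memLp_freePhase ε t) (𝓕 (potentialGen ε V (φ t))))
    (hcM _ (hF _ ((potentialGen ε V).continuous.comp_continuousOn h.continuousOn))) ?_
  · intro t ht
    exact ((fourierInvCLM ℂ (WaveSpace d)).hasFDerivAt.restrictScalars ℝ).comp_hasDerivWithinAt t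
      (key t ht)
  intro η hη hs t ht
  simp only [integral_mulOp_mul]
  set ηt : SchwartzMap (Pos d) ℂ := (hs.mul_left (f := freePhase ε t)).toSchwartzMap
    ((contDiff_freePhase ε t).mul hη) with hηt
  have hηt' : ∀ x, ηt x = freePhase ε t x * η x := fun x => rfl
  have hηc := hη.continuous
  have hfc : ∀ t, Continuous (freePhase (d := d) ε t) := fun t => (contDiff_freePhase ε t).continuous
  have hG : MemLp (fun ξ : Pos d => (2 * Real.pi ^ 2 * ε * ‖ξ‖ ^ 2) * ‖η ξ‖) 2 volume :=
    Continuous.memLp_of_hasCompactSupport (by fun_prop) hs.norm.mul_left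
  have hw := h.weak (𝓕 ηt) t ht
  simp only [← integral_fourier_mul_schwartz] at hw
  have := hasDerivWithinAt_integral_mul (f := fun s => 𝓕 (φ s))
    (c := fun s ξ => freePhase ε s ξ * η ξ)
    (c' := fun s ξ => Complex.I * (2 * Real.pi ^ 2 * ε * ‖ξ‖ ^ 2) * freePhase ε s ξ * η ξ)
    (convex_Icc 0 T) ht (hF _ h.continuousOn t ht)
    (fun τ => ((hfc τ).mul hηc).memLp_of_hasCompactSupport (hs.mul_left))
    (fun τ _ ξ => (hasDerivAt_freePhase ε τ ξ).mul_const _) hG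
    (fun τ _ ξ => by
      rw [norm_mul, norm_mul, norm_freePhase, mul_one, norm_mul, Complex.norm_I, one_mul]
      refine (mul_le_mul_of_nonneg_right (le_of_eq ?_) (norm_nonneg _))
      have : (2 * Real.pi ^ 2 * ε * ‖ξ‖ ^ 2 : ℂ) = ((2 * Real.pi ^ 2 * ε * ‖ξ‖ ^ 2 : ℝ) : ℂ) := by
        push_cast; rfl
      rw [this, Complex.norm_real, Real.norm_of_nonneg (by positivity)])
    hw
  convert this using 1
  have hI : ∀ g : SchwartzMap (Pos d) ℂ, Integrable (fun x => φ t x * g x) := fun g =>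
    integrable_mul_of_memLp (Lp.memLp _) (g.memLp 2)
  set sq : SchwartzMap (Pos d) ℂ := SchwartzMap.smulLeftCLM ℂ (fun x : Pos d => ‖x‖ ^ 2) ηt
    with hsq
  have hsq' : ∀ x, sq x = (‖x‖ ^ 2 : ℂ) * ηt x := by
    intro x
    rw [hsq, SchwartzMap.smulLeftCLM_apply_apply (by fun_prop)]
    simp [Complex.real_smul]
  have e1 : ∫ x, (𝓕 (potentialGen ε V (φ t)) : WaveSpace d) x * (freePhase ε t x * η x) =
      1 / (Complex.I * ε) * ∫ x, φ t x * (V x * (𝓕 ηt : SchwartzMap (Pos d) ℂ) x) := by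
    simp only [← hηt']
    rw [integral_fourier_mul_schwartz, ← integral_const_mul]
    refine integral_congr_ae ((coeFn_potentialGen ε V (φ t)).mono fun x hx => ?_)
    simp only [hx]; ring
  have e2 : ∫ x, (𝓕 (φ t) : WaveSpace d) x *
      (Complex.I * (2 * Real.pi ^ 2 * ε * ‖x‖ ^ 2) * freePhase ε t x * η x) =
      Complex.I * (2 * Real.pi ^ 2 * ε) * ∫ x, φ t x * (𝓕 sq : SchwartzMap (Pos d) ℂ) x := by
    rw [← integral_fourier_mul_schwartz, ← integral_const_mul]
    congr 1 with x
    rw [hsq', hηt']; ring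
  have e3 : ∫ x, φ t x * (-((ε : ℂ) ^ 2 / 2) *
      Laplacian.laplacian (𝓕 ηt : SchwartzMap (Pos d) ℂ) x
        + V x * (𝓕 ηt : SchwartzMap (Pos d) ℂ) x) =
      (2 * Real.pi ^ 2 * ε ^ 2) * (∫ x, φ t x * (𝓕 sq : SchwartzMap (Pos d) ℂ) x) +
        ∫ x, φ t x * (V x * (𝓕 ηt : SchwartzMap (Pos d) ℂ) x) := by
    rw [← integral_const_mul, ← integral_add ((hI _).const_mul _)]
    · congr 1 with x
      rw [laplacian_fourier]
      simp [Complex.real_smul]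
      ring
    · refine ((Lp.memLp (φ t)).integrable_mul (q := 2) ((𝓕 ηt).memLp 2 |>.mul' (memLp_potential V)))
  -- The kinetic contributions are `2π² ε i A` from the moving phase and `2π² ε² A / (iε)` from the
  -- equation; their sum is zero and only the potential term survives.
  rw [e1, e2, e3]
  have : (ε : ℂ) ≠ 0 := by exact_mod_cast hε.ne'
  generalize (∫ x, φ t x * (𝓕 sq : SchwartzMap (Pos d) ℂ) x) = A
  generalize ∫ x, φ t x * (V x * (𝓕 ηt : SchwartzMap (Pos d) ℂ) x) = B
  field_simp
  ring_nf
  simp [Complex.I_sq]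

/-- `V` is real and `1/(iε)` is purely imaginary, so the generator is skew-adjoint. -/
lemma inner_potentialGen (ε : ℝ) (V : Pos d →ᵇ ℝ) (φ ψ : WaveSpace d) :
    inner ℂ (potentialGen ε V ψ) φ + inner ℂ ψ (potentialGen ε V φ) = 0 := by
  rw [L2.inner_def, L2.inner_def, ← integral_add (L2.integrable_inner _ _)
    (L2.integrable_inner _ _)]
  refine integral_eq_zero_of_ae ?_
  filter_upwards [coeFn_potentialGen ε V φ, coeFn_potentialGen ε V ψ] with x h1 h2
  rw [h1, h2]
  simp [RCLike.inner_apply]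
  ring

/-- The Schrödinger flow preserves inner products. -/
lemma IsSchrodingerSolution.inner_eq {ε T : ℝ} (hε : 0 < ε) (hT : 0 < T) {V : Pos d →ᵇ ℝ}
    {φ ψ : ℝ → WaveSpace d} (hφ : IsSchrodingerSolution ε T V φ)
    (hψ : IsSchrodingerSolution ε T V ψ) :
    ∀ t ∈ Set.Icc 0 T, inner ℂ (ψ t) (φ t) = inner ℂ (ψ 0) (φ 0) := by
  have h1 : ∀ t ∈ Set.Icc 0 T,
      HasDerivWithinAt (fun s => inner ℂ (ψ s) (φ s)) 0 (Set.Icc 0 T) t := by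
    intro t ht
    have := (hψ.hasDerivWithinAt hε hT t ht).inner ℂ (hφ.hasDerivWithinAt hε hT t ht)
    -- `backFlow` is unitary, so it disappears from the inner product and from both terms of its
    -- derivative.
    simp only [inner_backFlow] at this
    rwa [add_comm, inner_potentialGen] at this
  exact constant_of_has_deriv_right_zero (fun s hs' => (h1 s hs').continuousWithinAt)
      (fun s hs' => ((h1 s ⟨hs'.1, hs'.2.le⟩).mono_of_mem_nhdsWithin
        (Icc_mem_nhdsGE_of_mem hs')))

end Schrodinger

/-! ### Changes of variables on phase space -/

section Coordinates

variable {d : ℕ}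

lemma measurePreserving_shear (t : ℝ) :
    MeasurePreserving (fun w : Phase d => (w.1 + t • w.2, w.2)) := by
  have h : MeasurePreserving (fun w : Phase d => (w.1, w.2 + t • w.1)) :=
    (MeasurePreserving.id (volume : Measure (Pos d))).skew_product
      (g := fun x y : Pos d => y + t • x) (by fun_prop)
      (ae_of_all _ fun x => map_add_right_eq_self _ _)
  exact (Measure.measurePreserving_swap.comp h).comp Measure.measurePreserving_swap

/-- The two endpoints `x ∓ (ε/2) y` of the chord with midpoint `x` and direction `y`. -/
def chord (ε : ℝ) (w : Phase d) : Phase d := (w.1 - (ε / 2) • w.2, w.1 + (ε / 2) • w.2)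

@[fun_prop] lemma measurable_chord (ε : ℝ) : Measurable (chord (d := d) ε) := by
  unfold chord; fun_prop

/-- The chord map is a shear, then the dilation of the second variable by `ε`, then another shear;
only the dilation changes volume. -/
lemma map_chord {ε : ℝ} (hε : 0 < ε) :
    Measure.map (chord (d := d) ε) volume = ENNReal.ofReal ((ε ^ d)⁻¹) • volume := by
  have h1 := measurePreserving_shear (d := d) (-(ε / 2))
  have h3 : MeasurePreserving (fun w : Phase d => (w.1, w.1 + w.2)) :=
    measurePreserving_prod_add volume volume
  have h2 : Measure.map (fun w : Phase d => (w.1, ε • w.2)) volume =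
      ENNReal.ofReal ((ε ^ d)⁻¹) • volume := by
    have h := Measure.map_addHaar_smul (volume : Measure (Pos d)) hε.ne'
    rw [abs_of_pos (by positivity), finrank_euclideanSpace_fin] at h
    have := Measure.map_prod_map (volume : Measure (Pos d)) (volume : Measure (Pos d))
      measurable_id (measurable_const_smul ε)
    rw [h, Measure.map_id, Measure.prod_smul_right] at this
    exact this.symm
  have e : chord (d := d) ε = (fun w : Phase d => (w.1, w.1 + w.2)) ∘
      (fun w : Phase d => (w.1, ε • w.2)) ∘ (fun w : Phase d => (w.1 + (-(ε / 2)) • w.2, w.2)) := by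
    ext1 w
    simp only [chord, Function.comp]
    ext1
    · simp [sub_eq_add_neg]
    · simp only
      module
  rw [e, ← Measure.map_map (by fun_prop) (by fun_prop), ← Measure.map_map (by fun_prop) (by fun_prop),
    h1.map_eq, h2, Measure.map_smul, h3.map_eq]

lemma integral_comp_chord {ε : ℝ} (hε : 0 < ε) {f : Phase d → ℂ}
    (hf : AEStronglyMeasurable f volume) :
    ∫ w, f (chord ε w) = ((ε : ℂ) ^ d)⁻¹ * ∫ w, f w := by
  rw [← integral_map (measurable_chord ε).aemeasurable (by rw [map_chord hε]; exact hf.smul_measure _),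
    map_chord hε, integral_smul_measure, ENNReal.toReal_ofReal (by positivity), Complex.real_smul]
  push_cast; rfl

lemma lintegral_comp_chord {ε : ℝ} (hε : 0 < ε) {f : Phase d → ℝ≥0∞} (hf : AEMeasurable f) :
    ∫⁻ w, f (chord ε w) = ENNReal.ofReal ((ε ^ d)⁻¹) * ∫⁻ w, f w := by
  rw [← lintegral_map' (by rw [map_chord hε]; exact hf.smul_measure _)
    (measurable_chord ε).aemeasurable, map_chord hε, lintegral_smul_measure, smul_eq_mul]

/-! ### The chord product and the `L²` identity for the Wigner transform. -/

/-- The density `φ₁(x - (ε/2) y) conj φ₂(x + (ε/2) y)` whose Fourier transform in `y` is the Wigner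
transform. -/
def chordProduct (ε : ℝ) (φ₁ φ₂ : WaveSpace d) (w : Phase d) : ℂ :=
  φ₁ (w.1 - (ε / 2) • w.2) * conj (φ₂ (w.1 + (ε / 2) • w.2))

lemma stronglyMeasurable_chordProduct (ε : ℝ) (φ₁ φ₂ : WaveSpace d) :
    StronglyMeasurable (chordProduct ε φ₁ φ₂) :=
  ((Lp.stronglyMeasurable φ₁).comp_measurable (by fun_prop)).mul
    (Complex.continuous_conj.comp_stronglyMeasurable
      ((Lp.stronglyMeasurable φ₂).comp_measurable (by fun_prop)))

lemma wignerTransform_eq_osc (ε : ℝ) (φ₁ φ₂ : WaveSpace d) (w : Phase d) :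
    wignerTransform ε φ₁ φ₂ w =
      (1 / (2 * Real.pi : ℂ) ^ d) * osc (fun y => chordProduct ε φ₁ φ₂ (w.1, y)) w.2 := by
  simp only [wignerTransform, osc, chordProduct, mul_assoc]

lemma memLp_comp_affine {r : ℝ} (hr : r ≠ 0) {f : Pos d → ℂ} (hf : MemLp f 2) (x : Pos d) :
    MemLp (fun y => f (x + r • y)) 2 := by
  have h1 : MemLp (fun y => f (x + y)) 2 :=
    hf.comp_measurePreserving (measurePreserving_add_left volume x)
  have h := Measure.map_addHaar_smul (volume : Measure (Pos d)) hr
  have : MemLp (fun y => f (x + y)) 2 (Measure.map (fun x => r • x) volume) := by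
    rw [h]; exact h1.smul_measure ENNReal.ofReal_ne_top
  exact this.comp_of_map (by fun_prop)

lemma integrable_chordProduct {ε : ℝ} (hε : 0 < ε) (φ₁ φ₂ : WaveSpace d) (x : Pos d) :
    Integrable (fun y => chordProduct ε φ₁ φ₂ (x, y)) := by
  have h1 := memLp_comp_affine (r := -(ε / 2)) (by linarith) (Lp.memLp φ₁) x
  have h2 := memLp_conj (memLp_comp_affine (r := ε / 2) (by positivity) (Lp.memLp φ₂) x)
  refine (integrable_mul_of_memLp h1 h2).congr (ae_of_all _ fun y => ?_)
  simp [chordProduct, sub_eq_add_neg]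

lemma lintegral_chordProduct {ε : ℝ} (hε : 0 < ε) (φ₁ φ₂ : WaveSpace d) :
    ∫⁻ w, ‖chordProduct ε φ₁ φ₂ w‖ₑ ^ 2 =
      ENNReal.ofReal ((ε ^ d)⁻¹) * (‖φ₁‖ₑ ^ 2 * ‖φ₂‖ₑ ^ 2) := by
  have hm1 : Measurable fun u => ‖φ₁ u‖ₑ ^ 2 := (Lp.stronglyMeasurable φ₁).measurable.enorm.pow_const 2
  have hm2 : Measurable fun u => ‖φ₂ u‖ₑ ^ 2 := (Lp.stronglyMeasurable φ₂).measurable.enorm.pow_const 2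
  have := lintegral_comp_chord hε (f := fun w : Phase d => ‖φ₁ w.1‖ₑ ^ 2 * ‖φ₂ w.2‖ₑ ^ 2)
    (by fun_prop)
  have h2 := lintegral_prod_mul (μ := (volume : Measure (Pos d))) (ν := (volume : Measure (Pos d)))
    hm1.aemeasurable hm2.aemeasurable
  have e : ∀ φ : WaveSpace d, ∫⁻ u, ‖φ u‖ₑ ^ 2 = ‖φ‖ₑ ^ 2 := fun φ => by
    rw [← enorm_toLp_sq (Lp.memLp φ), Lp.toLp_coeFn]
  rw [e, e] at h2
  rw [← h2]
  refine Eq.trans (lintegral_congr fun w => ?_) this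
  simp [chordProduct, chord, enorm_mul, mul_pow]

/-- Plancherel in `y` needs the chord product in `L¹ ∩ L²` of the fibre. Integrability holds over
every `x` by Cauchy–Schwarz; square integrability only over almost every `x`, by Tonelli. -/
lemma ae_memLp_chordProduct {ε : ℝ} (hε : 0 < ε) (φ₁ φ₂ : WaveSpace d) :
    ∀ᵐ x : Pos d, MemLp (fun y => chordProduct ε φ₁ φ₂ (x, y)) 2 := by
  have h := lintegral_chordProduct hε φ₁ φ₂
  have hm := (stronglyMeasurable_chordProduct ε φ₁ φ₂)
  have hm2 : Measurable fun w => ‖chordProduct ε φ₁ φ₂ w‖ₑ ^ 2 := hm.measurable.enorm.pow_const 2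
  have h2 : ∫⁻ x : Pos d, ∫⁻ y : Pos d, ‖chordProduct ε φ₁ φ₂ (x, y)‖ₑ ^ 2 ≠ ⊤ := by
    rw [← lintegral_prod _ hm2.aemeasurable, ← Measure.volume_eq_prod, h]
    exact ENNReal.mul_ne_top ENNReal.ofReal_ne_top
      (ENNReal.mul_ne_top (by finiteness) (by finiteness))
  filter_upwards [ae_lt_top hm2.lintegral_prod_right' h2] with x hx
  exact (memLp_two_iff (hm.comp_measurable measurable_prodMk_left).aestronglyMeasurable).2 hx

lemma stronglyMeasurable_osc_fibre {F : Phase d → ℂ} (hF : StronglyMeasurable F) :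
    StronglyMeasurable fun w : Phase d => osc (fun y => F (w.1, y)) w.2 := by
  have : StronglyMeasurable (fun q : Phase d × Pos d => cis (inner ℝ q.1.2 q.2) * F (q.1.1, q.2)) :=
    (by fun_prop : Continuous fun q : Phase d × Pos d =>
      cis (inner ℝ q.1.2 q.2)).stronglyMeasurable.mul (hF.comp_measurable (by fun_prop))
  exact this.integral_prod_right'

lemma stronglyMeasurable_wignerTransform (ε : ℝ) (φ₁ φ₂ : WaveSpace d) :
    StronglyMeasurable (wignerTransform ε φ₁ φ₂) := by
  rw [show wignerTransform ε φ₁ φ₂ = _ from funext (wignerTransform_eq_osc ε φ₁ φ₂)]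
  exact (stronglyMeasurable_osc_fibre (stronglyMeasurable_chordProduct ε φ₁ φ₂)).const_mul _

/-- Plancherel's theorem in the second variable. -/
lemma lintegral_osc_fibre {F : Phase d → ℂ} (hF : StronglyMeasurable F)
    (h1 : ∀ᵐ x : Pos d, Integrable fun y => F (x, y))
    (h2 : ∀ᵐ x : Pos d, MemLp (fun y => F (x, y)) 2) :
    ∫⁻ w : Phase d, ‖osc (fun y => F (w.1, y)) w.2‖ₑ ^ 2 =
      ENNReal.ofReal ((2 * Real.pi) ^ d) * ∫⁻ w, ‖F w‖ₑ ^ 2 := by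
  rw [Measure.volume_eq_prod, lintegral_prod _
    ((stronglyMeasurable_osc_fibre hF).measurable.enorm.pow_const 2).aemeasurable,
    lintegral_prod _ (hF.measurable.enorm.pow_const 2).aemeasurable,
    ← lintegral_const_mul' _ _ ENNReal.ofReal_ne_top]
  refine lintegral_congr_ae ?_
  filter_upwards [h1, h2] with x h1 h2
  exact lintegral_osc h1 h2

/-- The square of the norm of the Wigner transform as a sesquilinear map. -/
def wignerConst (d : ℕ) (ε : ℝ) : ℝ≥0∞ :=
  ‖(1 / (2 * Real.pi : ℂ) ^ d)‖ₑ ^ 2 * (ENNReal.ofReal ((2 * Real.pi) ^ d) *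
    ENNReal.ofReal ((ε ^ d)⁻¹))

lemma wignerConst_ne_top (d : ℕ) (ε : ℝ) : wignerConst d ε ≠ ⊤ := by
  unfold wignerConst; finiteness

lemma lintegral_wignerTransform {ε : ℝ} (hε : 0 < ε) (φ₁ φ₂ : WaveSpace d) :
    ∫⁻ w, ‖wignerTransform ε φ₁ φ₂ w‖ₑ ^ 2 = wignerConst d ε * (‖φ₁‖ₑ ^ 2 * ‖φ₂‖ₑ ^ 2) := by
  simp only [wignerTransform_eq_osc, enorm_mul, mul_pow]
  rw [lintegral_const_mul' _ _ (by finiteness), lintegral_osc_fibre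
    (stronglyMeasurable_chordProduct ε φ₁ φ₂) (ae_of_all _ (integrable_chordProduct hε φ₁ φ₂))
    (ae_memLp_chordProduct hε φ₁ φ₂), lintegral_chordProduct hε, wignerConst]
  ring_nf

lemma memLp_wignerTransform {ε : ℝ} (hε : 0 < ε) (φ₁ φ₂ : WaveSpace d) :
    MemLp (wignerTransform ε φ₁ φ₂) 2 := by
  rw [memLp_two_iff (stronglyMeasurable_wignerTransform ε φ₁ φ₂).aestronglyMeasurable,
    lintegral_wignerTransform hε]
  have := wignerConst_ne_top d ε
  finiteness

end Coordinates

/-! ### Parity operators -/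

section Parity

variable {d : ℕ}

lemma memLp_cis_inner (b : Pos d) : MemLp (fun u : Pos d => cis (inner ℝ b u)) ⊤ volume :=
  memLp_top_of_bound (by fun_prop : Continuous _).aestronglyMeasurable 1
    (ae_of_all _ fun x => by simp)

/-- The reflected and modulated function `u ↦ e^{i b·u} φ(a - u)`. -/
def parityOp (a b : Pos d) : WaveSpace d →L[ℂ] WaveSpace d :=
  mulOp (memLp_cis_inner b) ∘L (Lp.compMeasurePreservingₗᵢ ℂ (fun u : Pos d => a - u)
    (Measure.measurePreserving_sub_left volume a)).toContinuousLinearMap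

lemma coeFn_parityOp (a b : Pos d) (φ : WaveSpace d) :
    parityOp a b φ =ᵐ[volume] fun u => cis (inner ℝ b u) * φ (a - u) := by
  filter_upwards [coeFn_mulOp (memLp_cis_inner b) (Lp.compMeasurePreserving _
    (Measure.measurePreserving_sub_left volume a) φ),
    Lp.coeFn_compMeasurePreserving φ (Measure.measurePreserving_sub_left volume a)] with u h1 h2
  refine Eq.trans h1 ?_
  rw [h2]; rfl

/-- The substitution `u = x + (ε/2) y` exhibits the Wigner transform as a matrix element of a
reflection through `x` followed by a modulation. As this holds at every point of phase space,
sesquilinearity and covariance under the free flow become statements about operators. -/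
lemma wignerTransform_eq_inner {ε : ℝ} (hε : 0 < ε) (φ₁ φ₂ : WaveSpace d) (w : Phase d) :
    wignerTransform ε φ₁ φ₂ w = (1 / (2 * Real.pi : ℂ) ^ d) * ((((ε / 2 : ℝ) : ℂ) ^ d)⁻¹ *
      (cis (-inner ℝ ((2 / ε) • w.2) w.1) *
        inner ℂ φ₂ (parityOp ((2 : ℝ) • w.1) ((2 / ε) • w.2) φ₁))) := by
  obtain ⟨x, k⟩ := w
  simp only [wignerTransform]
  congr 1
  have := integral_comp_smul' (r := ε / 2) (by positivity)
    (fun v : Pos d => cis (inner ℝ ((2 / ε) • k) v) * φ₁ (x - v) * conj (φ₂ (x + v)))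
  have e : ∀ y : Pos d, inner ℝ ((2 / ε) • k) ((ε / 2) • y) = inner ℝ k y := by
    intro y
    rw [inner_smul_left, inner_smul_right]; simp; field_simp
  simp only [e] at this
  rw [this]
  congr 1
  rw [L2.inner_def, ← integral_const_mul, ← integral_sub_right_eq_self (fun v : Pos d =>
    cis (inner ℝ ((2 / ε) • k) v) * φ₁ (x - v) * conj (φ₂ (x + v))) x]
  refine integral_congr_ae ?_
  filter_upwards [coeFn_parityOp ((2 : ℝ) • x) ((2 / ε) • k) φ₁] with u hu
  rw [hu, add_sub_cancel, show x - (u - x) = (2 : ℝ) • x - u by module, inner_sub_right,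
    sub_eq_add_neg, cis_add]
  simp only [RCLike.inner_apply]; ring

/-- Parity operators are intertwined by the inverse Fourier transform. -/
lemma fourierInv_parityOp (a b : Pos d) (φ : WaveSpace d) :
    (𝓕⁻ (parityOp a b φ) : WaveSpace d) = cis (inner ℝ b a) •
      parityOp (-((2 * Real.pi)⁻¹ • b)) ((2 * Real.pi) • a) (𝓕⁻ φ) := by
  -- Both sides are continuous in `φ`, so a Schwartz function suffices; there the transform is an
  -- integral and the substitution `u ↦ a - u` gives the claim.
  refine DenseRange.induction_on
    (p := fun φ : WaveSpace d => (𝓕⁻ (parityOp a b φ) : WaveSpace d) = cis (inner ℝ b a) •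
      parityOp (-((2 * Real.pi)⁻¹ • b)) ((2 * Real.pi) • a) (𝓕⁻ φ))
    (SchwartzMap.denseRange_toLpCLM (p := 2) (μ := (volume : Measure (Pos d)))
    ENNReal.ofNat_ne_top) φ ?_ ?_
  · exact isClosed_eq ((fourierInvCLM ℂ (WaveSpace d)).continuous.comp (parityOp a b).continuous)
      (((parityOp _ _).continuous.comp (fourierInvCLM ℂ (WaveSpace d)).continuous).const_smul
        (cis (inner ℝ b a)))
  intro χ
  simp only [SchwartzMap.toLpCLM_apply]
  have hmp := Measure.measurePreserving_sub_left (volume : Measure (Pos d)) a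
  set p : Pos d → ℂ := fun u => cis (inner ℝ b u) * χ (a - u) with hp
  have hpc : Continuous fun u : Pos d => cis (inner ℝ b u) := by fun_prop
  have hp1 : Integrable p :=
    ((hmp.integrable_comp_emb (MeasurableEquiv.subLeft a).measurableEmbedding).2
      χ.integrable).bdd_mul (c := 1) hpc.aestronglyMeasurable (ae_of_all _ fun u => by simp)
  have hp2 : MemLp p 2 :=
    MemLp.mul' (p := ⊤) (q := 2) ((χ.memLp 2).comp_measurePreserving hmp) (memLp_cis_inner b)
  have hχ : ∀ f : SchwartzMap (Pos d) ℂ, ∀ᵐ x, f.toLp 2 volume x = f x := fun f =>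
    f.coeFn_toLp 2 volume
  have e1 : parityOp a b (χ.toLp 2) = hp2.toLp p := by
    refine Lp.ext ?_
    filter_upwards [coeFn_parityOp a b (χ.toLp 2), hp2.coeFn_toLp,
      hmp.quasiMeasurePreserving.ae (hχ χ)] with u h1 h2 h3
    rw [h1, h2, h3]
  rw [e1, SchwartzMap.toLp_fourierInv_eq]
  set a' : Pos d := -((2 * Real.pi)⁻¹ • b) with ha'
  refine Lp.ext ?_
  filter_upwards [coeFn_fourierInv_toLp hp1 hp2,
    Lp.coeFn_smul (cis (inner ℝ b a)) (parityOp a' ((2 * Real.pi) • a) ((𝓕⁻ χ).toLp 2)),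
    coeFn_parityOp a' ((2 * Real.pi) • a) ((𝓕⁻ χ).toLp 2),
    (Measure.measurePreserving_sub_left volume a').quasiMeasurePreserving.ae (hχ (𝓕⁻ χ))]
    with ξ h1 h2 h3 h4
  rw [h1, h2, Pi.smul_apply, h3, h4, SchwartzMap.fourierInv_coe, fourierInv_eq_osc,
    fourierInv_eq_osc, osc, osc, ← integral_sub_left_eq_self _ _ a, smul_eq_mul,
    ← integral_const_mul, ← integral_const_mul]
  congr 1 with u
  simp only [hp, sub_sub_cancel, ← mul_assoc, ← cis_add]
  congr 2
  simp only [ha', inner_sub_right, inner_sub_left, inner_smul_left,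
    inner_neg_left, smul_sub, smul_neg, smul_smul]
  rw [mul_inv_cancel₀ (by positivity)]
  simp only [RCLike.conj_to_real]
  rw [real_inner_comm ξ a]
  ring

lemma fourier_parityOp (a b : Pos d) (φ : WaveSpace d) :
    (𝓕 (parityOp a b φ) : WaveSpace d) = cis (inner ℝ b a) •
      parityOp ((2 * Real.pi)⁻¹ • b) (-((2 * Real.pi) • a)) (𝓕 φ) := by
  have h := fourierInv_parityOp ((2 * Real.pi)⁻¹ • b) (-((2 * Real.pi) • a)) (𝓕 φ)
  have e1 : -((2 * Real.pi)⁻¹ • -((2 * Real.pi) • a)) = a := by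
    rw [smul_neg, smul_smul, inv_mul_cancel₀ (by positivity), one_smul, neg_neg]
  have e2 : (2 * Real.pi) • (2 * Real.pi)⁻¹ • b = b := by
    rw [smul_smul, mul_inv_cancel₀ (by positivity), one_smul]
  rw [e1, e2, FourierTransform.fourierInv_fourier_eq] at h
  have h2 := congrArg (fun u : WaveSpace d => cis (inner ℝ b a) • (𝓕 u : WaveSpace d)) h
  simp only [FourierTransform.fourier_fourierInv_eq, FourierTransform.fourier_smul] at h2
  rw [h2, smul_smul, ← cis_add]
  have : inner ℝ b a + inner ℝ (-((2 * Real.pi) • a)) ((2 * Real.pi)⁻¹ • b) = 0 := by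
    simp only [inner_neg_left, inner_smul_left, inner_smul_right, RCLike.conj_to_real]
    rw [real_inner_comm a b]
    field_simp
    ring
  rw [this, cis_zero, one_smul]

/-- On the frequency side the parity operator reflects `ξ` to `κ - ξ`, so the two free phases
combine to `‖κ - ξ‖² - ‖ξ‖² = ‖κ‖² - 2 κ·ξ`. This is affine in `ξ` because the symbol is quadratic:
the constant is a scalar phase, the linear part a modulation that translates `a` along `b`. -/
lemma inner_backFlow_parityOp (ε t : ℝ) (a b : Pos d) (φ₁ φ₂ : WaveSpace d) :
    inner ℂ (backFlow ε t φ₂) (parityOp a b (backFlow ε t φ₁)) =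
      cis (-(t * ε / 2 * ‖b‖ ^ 2)) * inner ℂ φ₂ (parityOp (a + (t * ε) • b) b φ₁) := by
  rw [← Lp.inner_fourier_eq, fourier_parityOp, ← Lp.inner_fourier_eq φ₂, fourier_parityOp,
    fourier_backFlow, fourier_backFlow, inner_smul_right, inner_smul_right, ← mul_assoc, ← cis_add]
  set κ : Pos d := (2 * Real.pi)⁻¹ • b with hκ
  have hb : b = (2 * Real.pi) • κ := by
    rw [hκ, smul_smul, mul_inv_cancel₀ (by positivity), one_smul]
  rw [L2.inner_def, L2.inner_def, ← integral_const_mul, ← integral_const_mul]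
  refine integral_congr_ae ?_
  filter_upwards [coeFn_mulOp (memLp_freePhase ε t) (𝓕 φ₂),
    coeFn_parityOp κ (-((2 * Real.pi) • a)) (mulOp (memLp_freePhase ε t) (𝓕 φ₁)),
    coeFn_parityOp κ (-((2 * Real.pi) • (a + (t * ε) • b))) (𝓕 φ₁),
    (Measure.measurePreserving_sub_left volume κ).quasiMeasurePreserving.ae
      (coeFn_mulOp (memLp_freePhase ε t) (𝓕 φ₁))] with ξ h1 h2 h3 h4
  rw [h1, h2, h3, h4]
  simp only [RCLike.inner_apply, map_mul, freePhase, conj_cis]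
  have e : cis (inner ℝ b a) * (cis (inner ℝ (-((2 * Real.pi) • a)) ξ) *
      (cis (t * (2 * Real.pi ^ 2 * ε * ‖κ - ξ‖ ^ 2)) * cis (-(t * (2 * Real.pi ^ 2 * ε * ‖ξ‖ ^ 2)))))
      = cis (-(t * ε / 2 * ‖b‖ ^ 2) + inner ℝ b (a + (t * ε) • b)) *
        cis (inner ℝ (-((2 * Real.pi) • (a + (t * ε) • b))) ξ) := by
    simp only [← cis_add]
    congr 1
    rw [norm_sub_sq_real, hb]
    simp only [inner_add_right, inner_neg_left, inner_smul_left, inner_smul_right, inner_add_left,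
      RCLike.conj_to_real, norm_smul, real_inner_self_eq_norm_sq, Real.norm_eq_abs, mul_pow, sq_abs,
      smul_add]
    ring
  linear_combination ((𝓕 φ₁ : WaveSpace d) (κ - ξ) * conj ((𝓕 φ₂ : WaveSpace d) ξ)) * e

/-- The Wigner transform turns the free Schrödinger flow into free transport. -/
lemma wignerTransform_backFlow {ε : ℝ} (hε : 0 < ε) (t : ℝ) (φ₁ φ₂ : WaveSpace d) (w : Phase d) :
    wignerTransform ε (backFlow ε t φ₁) (backFlow ε t φ₂) w =
      wignerTransform ε φ₁ φ₂ (w.1 + t • w.2, w.2) := by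
  rw [wignerTransform_eq_inner hε, wignerTransform_eq_inner hε, inner_backFlow_parityOp]
  obtain ⟨x, k⟩ := w
  simp only
  have e1 : (2 : ℝ) • x + (t * ε) • (2 / ε) • k = (2 : ℝ) • (x + t • k) := by
    rw [smul_smul, smul_add, smul_smul]; congr 2; field_simp
  rw [e1, ← mul_assoc (cis _), ← cis_add]
  congr 5
  simp only [norm_smul, inner_smul_left, inner_add_right, inner_smul_right, RCLike.conj_to_real,
    real_inner_self_eq_norm_sq, mul_pow, Real.norm_eq_abs, sq_abs]
  field_simp
  ring

end Parity

/-! ### The Wigner transform as a bounded map -/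

section WignerL2

variable {d : ℕ} {ε : ℝ}

/-- The Wigner transform as an element of `L²`. -/
def wignerL2 (hε : 0 < ε) : WaveSpace d →L[ℝ] WaveSpace d →L[ℝ] PhaseSpaceL2 d :=
  -- The map is conjugate-linear in its second argument; real bilinearity is what the product rule
  -- in time requires.
  LinearMap.mkContinuous₂ (LinearMap.mk₂ ℝ
    (fun φ₁ φ₂ => (memLp_wignerTransform hε φ₁ φ₂).toLp)
    (fun φ₁ φ₁' φ₂ => by
      rw [← MemLp.toLp_add]; congr 1; ext1 w
      simp only [Pi.add_apply, wignerTransform_eq_inner hε, map_add, inner_add_right]; ring)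
    (fun c φ₁ φ₂ => by
      rw [← MemLp.toLp_const_smul]; congr 1; ext1 w
      simp only [Pi.smul_apply, wignerTransform_eq_inner hε, ContinuousLinearMap.map_smul_of_tower,
        inner_smul_right_eq_smul, Complex.real_smul]; ring)
    (fun φ₁ φ₂ φ₂' => by
      rw [← MemLp.toLp_add]; congr 1; ext1 w
      simp only [Pi.add_apply, wignerTransform_eq_inner hε, inner_add_left]; ring)
    (fun c φ₁ φ₂ => by
      rw [← MemLp.toLp_const_smul]; congr 1; ext1 w
      simp only [Pi.smul_apply, wignerTransform_eq_inner hε,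
        inner_smul_left_eq_smul, Complex.real_smul]; ring))
    (Real.sqrt (wignerConst d ε).toReal) (fun φ₁ φ₂ => by
      have h := lintegral_wignerTransform hε φ₁ φ₂
      rw [← enorm_toLp_sq (memLp_wignerTransform hε φ₁ φ₂)] at h
      have h2 := congrArg ENNReal.toReal h
      simp only [ENNReal.toReal_mul, ENNReal.toReal_pow, toReal_enorm] at h2
      refine (pow_le_pow_iff_left₀ (norm_nonneg _) (by positivity) two_ne_zero).1 ?_
      refine h2.le.trans_eq ?_
      rw [mul_pow, mul_pow, Real.sq_sqrt ENNReal.toReal_nonneg, mul_assoc])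

lemma coeFn_wignerL2 (hε : 0 < ε) (φ₁ φ₂ : WaveSpace d) :
    wignerL2 hε φ₁ φ₂ =ᵐ[volume] wignerTransform ε φ₁ φ₂ :=
  (memLp_wignerTransform hε φ₁ φ₂).coeFn_toLp

end WignerL2

/-! ### The transport and potential operators on test functions -/

section Operators

variable {d : ℕ}

instance : (volume : Measure (Phase d)).IsAddHaarMeasure :=
  inferInstanceAs (Measure.IsAddHaarMeasure
    ((volume : Measure (Pos d)).prod (volume : Measure (Pos d))))

/-- The free transport map `(x, k) ↦ (x + s k, k)`. -/
def shear (s : ℝ) : Phase d ≃L[ℝ] Phase d :=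
  ContinuousLinearEquiv.equivOfInverse
    (ContinuousLinearMap.prod (ContinuousLinearMap.fst ℝ (Pos d) (Pos d) +
      s • ContinuousLinearMap.snd ℝ (Pos d) (Pos d)) (ContinuousLinearMap.snd ℝ (Pos d) (Pos d)))
    (ContinuousLinearMap.prod (ContinuousLinearMap.fst ℝ (Pos d) (Pos d) -
      s • ContinuousLinearMap.snd ℝ (Pos d) (Pos d)) (ContinuousLinearMap.snd ℝ (Pos d) (Pos d)))
    (fun w => by simp) (fun w => by simp)

lemma shear_apply (s : ℝ) (w : Phase d) : shear s w = (w.1 + s • w.2, w.2) := rfl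

lemma shear_shear_neg (s : ℝ) (w : Phase d) : shear s (shear (-s) w) = w := by
  simp [shear_apply]

lemma measurePreserving_shear' (s : ℝ) : MeasurePreserving (shear (d := d) s) :=
  measurePreserving_shear s

lemma integral_comp_shear (s : ℝ) (f : Phase d → ℂ) : ∫ w, f (shear s w) = ∫ w, f w :=
  (measurePreserving_shear' s).integral_comp (shear s).toHomeomorph.measurableEmbedding f

/-- Composition of a test function with the free transport map. -/
def shearComp (s : ℝ) (χ : SchwartzMap (Phase d) ℂ) : SchwartzMap (Phase d) ℂ :=
  SchwartzMap.compCLMOfContinuousLinearEquiv ℂ (shear s) χ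

lemma shearComp_apply (s : ℝ) (χ : SchwartzMap (Phase d) ℂ) (w : Phase d) :
    shearComp s χ w = χ (shear s w) := rfl

lemma norm_toLp_shearComp (s : ℝ) (χ : SchwartzMap (Phase d) ℂ) :
    ‖(shearComp s χ).toLp 2‖ = ‖χ.toLp 2‖ := by
  rw [SchwartzMap.norm_toLp, SchwartzMap.norm_toLp,
    ← eLpNorm_comp_measurePreserving χ.continuous.aestronglyMeasurable (measurePreserving_shear' s)]
  rfl

/-- The transport derivative `k · ∇ₓ χ` as a Schwartz function. -/
def transportS (χ : SchwartzMap (Phase d) ℂ) : SchwartzMap (Phase d) ℂ :=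
  SchwartzMap.bilinLeftCLM (𝕜 := ℝ) (ContinuousLinearMap.id ℝ (Phase d →L[ℝ] ℂ))
    (g := (ContinuousLinearMap.inl ℝ (Pos d) (Pos d)).comp (ContinuousLinearMap.snd ℝ _ _))
    (ContinuousLinearMap.hasTemperateGrowth _) (SchwartzMap.fderivCLM ℝ (Phase d) ℂ χ)

lemma transport_shearComp (s : ℝ) (χ : SchwartzMap (Phase d) ℂ) (w : Phase d) :
    transport (shearComp s χ) w = transport χ (shear s w) := by
  have h : HasFDerivAt (shearComp s χ : Phase d → ℂ)
      ((fderiv ℝ χ (shear s w)).comp (shear (d := d) s : Phase d →L[ℝ] Phase d)) w := by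
    have h1 : HasFDerivAt (χ : Phase d → ℂ) (fderiv ℝ χ (shear s w)) (shear s w) :=
      χ.differentiableAt.hasFDerivAt
    have h2 : HasFDerivAt (shear (d := d) s) (shear (d := d) s : Phase d →L[ℝ] Phase d) w :=
      ContinuousLinearEquiv.hasFDerivAt _
    exact h1.comp w h2
  rw [transport, transport, h.fderiv]
  simp [shear_apply]

lemma hasDerivAt_comp_shear (χ : SchwartzMap (Phase d) ℂ) (w : Phase d) (s : ℝ) :
    HasDerivAt (fun s => χ (shear s w)) (transport χ (shear s w)) s := by
  have h : HasDerivAt (fun s : ℝ => shear s w) (w.2, 0) s := by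
    simp only [shear_apply]
    have h1 : HasDerivAt (fun s : ℝ => w.1 + s • w.2) w.2 s := by
      simpa using ((hasDerivAt_id s).smul_const w.2).const_add w.1
    exact h1.prodMk (hasDerivAt_const s w.2)
  exact ((χ.differentiableAt (x := shear s w)).hasFDerivAt).comp_hasDerivAt s h

/-- Translates of a Schwartz function under free transport have a common `L²` bound. -/
lemma exists_memLp_bound_comp_shear (χ : SchwartzMap (Phase d) ℂ) (T : ℝ) :
    ∃ G : Phase d → ℝ, MemLp G 2 volume ∧ ∀ s, |s| ≤ T → ∀ w, ‖χ (shear s w)‖ ≤ G w := by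
  rcases lt_or_ge T 0 with hT | hT
  · exact ⟨0, MemLp.zero, fun s hs => absurd ((abs_nonneg s).trans hs) (not_le.2 hT)⟩
  -- One power above the dimension makes `(1 + ‖w‖)^(-N)` integrable; being at most `1`, it is also
  -- square integrable.
  set N := Module.finrank ℝ (Phase d) + 1 with hN
  obtain ⟨C, hC⟩ : ∃ C : ℝ, ∀ w, (1 + ‖w‖) ^ N * ‖χ w‖ ≤ C :=
    ⟨_, fun w => by
      simpa using SchwartzMap.one_add_le_sup_seminorm_apply (𝕜 := ℝ) (m := (N, 0)) le_rfl le_rfl χ w⟩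
  have hC0 : 0 ≤ C := (by positivity : (0 : ℝ) ≤ _).trans (hC 0)
  have hI : Integrable (fun w : Phase d => (1 + ‖w‖) ^ (-(N : ℝ))) :=
    integrable_one_add_norm (by rw [hN]; push_cast; linarith)
  have hI2 : MemLp (fun w : Phase d => (1 + ‖w‖) ^ (-(N : ℝ))) 2 := by
    rw [memLp_two_iff_integrable_sq hI.1]
    refine hI.mono (hI.1.pow 2) (ae_of_all _ fun w => ?_)
    have h0 : 0 ≤ (1 + ‖w‖) ^ (-(N : ℝ)) := by positivity
    have h1 : (1 + ‖w‖) ^ (-(N : ℝ)) ≤ 1 :=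
      Real.rpow_le_one_of_one_le_of_nonpos (by linarith [norm_nonneg w]) (by simp)
    rw [Real.norm_of_nonneg h0, Real.norm_of_nonneg (by positivity)]
    nlinarith
  refine ⟨_, hI2.const_mul (C * (1 + T) ^ N), fun s hs w => ?_⟩
  -- The inverse shear has norm at most `1 + |s|`, so decay at `shear s w` gives decay at `w`
  -- uniformly in `s`.
  have h1 : ‖w‖ ≤ (1 + T) * ‖shear s w‖ := by
    set v := shear s w with hv
    have : w = (v.1 - s • v.2, v.2) := by simp [hv, shear_apply]
    rw [this, Prod.norm_def]
    refine max_le ?_ ?_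
    · refine (norm_sub_le _ _).trans ?_
      rw [norm_smul, Real.norm_eq_abs, add_mul, one_mul]
      exact add_le_add (norm_fst_le v) (mul_le_mul hs (norm_snd_le v) (norm_nonneg _) hT)
    · refine (norm_snd_le v).trans ?_
      nlinarith [norm_nonneg v]
  have h2 : 1 + ‖w‖ ≤ (1 + T) * (1 + ‖shear s w‖) := by nlinarith
  have h3 : (1 + ‖w‖) ^ N ≤ (1 + T) ^ N * (1 + ‖shear s w‖) ^ N := by
    rw [← mul_pow]; exact pow_le_pow_left₀ (by positivity) h2 N
  rw [Real.rpow_neg (by positivity), Real.rpow_natCast, ← div_eq_mul_inv, le_div_iff₀ (by positivity)]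
  calc ‖χ (shear s w)‖ * (1 + ‖w‖) ^ N
      ≤ ‖χ (shear s w)‖ * ((1 + T) ^ N * (1 + ‖shear s w‖) ^ N) := by gcongr
    _ = (1 + T) ^ N * ((1 + ‖shear s w‖) ^ N * ‖χ (shear s w)‖) := by ring
    _ ≤ (1 + T) ^ N * C := by gcongr; exact hC _
    _ = C * (1 + T) ^ N := by ring

/-! ### The potential operator, fibre by fibre. -/

/-- The restriction of a Schwartz function on phase space to the fibre over `x`. -/
def fibre (χ : SchwartzMap (Phase d) ℂ) (x : Pos d) : SchwartzMap (Pos d) ℂ :=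
  SchwartzMap.compCLM ℂ (g := fun p : Pos d => (x, p))
    (by
      have h1 : (fun p : Pos d => ((x, 0) : Phase d)).HasTemperateGrowth := .const _
      have h2 := (ContinuousLinearMap.inr ℝ (Pos d) (Pos d)).hasTemperateGrowth
      convert h1.add h2 using 1
      ext1 p; simp)
    ⟨1, 1, fun p => by
      have := norm_snd_le ((x, p) : Phase d)
      simp only at this
      linarith⟩ χ

lemma fibre_apply (χ : SchwartzMap (Phase d) ℂ) (x p : Pos d) : fibre χ x p = χ (x, p) := rfl

lemma osc_neg_eq_fourier (χ : SchwartzMap (Pos d) ℂ) (y : Pos d) :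
    osc χ (-y) = 𝓕 χ ((2 * Real.pi)⁻¹ • y) := by
  rw [SchwartzMap.fourier_coe, fourier_eq_osc, smul_smul, mul_inv_cancel₀ (by positivity), one_smul]

lemma integrable_osc_schwartz (χ : SchwartzMap (Pos d) ℂ) : Integrable (osc χ) := by
  have : (osc χ) = fun y => 𝓕 χ ((-(2 * Real.pi)⁻¹) • y) := by
    ext1 y; rw [← neg_neg y, osc_neg_eq_fourier]; congr 1; simp
  rw [this]
  exact (integrable_comp_smul_iff volume _ (by simp [Real.pi_ne_zero])).2 (𝓕 χ).integrable

lemma memLp_osc_schwartz (χ : SchwartzMap (Pos d) ℂ) : MemLp (osc χ) 2 :=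
  memLp_osc χ.integrable (χ.memLp 2)

/-- The bilinear form of Parseval follows from the sesquilinear one applied to `y ↦ conj (f (-y))`,
whose Fourier integral is the conjugate of that of `f`. -/
lemma integral_osc_mul_osc {f g : Pos d → ℂ} (hf1 : Integrable f) (hf2 : MemLp f 2)
    (hg1 : Integrable g) (hg2 : MemLp g 2) :
    ∫ k, osc f k * osc g k = (2 * Real.pi : ℂ) ^ d * ∫ y, f (-y) * g y := by
  have hn := Measure.measurePreserving_neg (volume : Measure (Pos d))
  have h1 : Integrable fun y => conj (f (-y)) := by
    have := hf1.comp_neg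
    exact (Complex.conjLIE.toContinuousLinearEquiv.integrable_comp_iff).2 this
  have h2 : MemLp (fun y => conj (f (-y))) 2 := memLp_conj (hf2.comp_measurePreserving hn)
  have := integral_conj_osc_mul_osc h1 h2 hg1 hg2
  have e : ∀ k, conj (osc (fun y => conj (f (-y))) k) = osc f k := by
    intro k
    rw [osc, osc, ← integral_conj, ← integral_neg_eq_self]
    congr 1 with y
    simp [conj_cis]
  simpa [e] using this

/-- This oddness is the source of the skew-symmetry of `L_V` for the bilinear pairing, in which
Parseval reflects `y`. -/
lemma potentialDiff_neg (ε : ℝ) (V : Pos d →ᵇ ℝ) (x y : Pos d) :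
    potentialDiff ε V x (-y) = -potentialDiff ε V x y := by
  simp only [potentialDiff, smul_neg, sub_neg_eq_add, ← sub_eq_add_neg]; ring

lemma continuous_potentialDiff (ε : ℝ) (V : Pos d →ᵇ ℝ) :
    Continuous fun w : Phase d => potentialDiff ε V w.1 w.2 := by
  unfold potentialDiff; fun_prop

lemma norm_potentialDiff_le {ε : ℝ} (hε : 0 < ε) (V : Pos d →ᵇ ℝ) (x y : Pos d) :
    ‖(potentialDiff ε V x y : ℂ)‖ ≤ 2 * ‖V‖ / ε := by
  rw [Complex.norm_real, potentialDiff, norm_mul, Real.norm_of_nonneg (by positivity),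
    one_div, inv_mul_eq_div]
  gcongr
  refine (norm_sub_le _ _).trans ?_
  linarith [V.norm_coe_le_norm (x + (ε / 2) • y), V.norm_coe_le_norm (x - (ε / 2) • y)]

/-- The function `δ[V](x, y) χ̂(x, y)`, where the Fourier transform is in the second variable. -/
def wignerSymbol (ε : ℝ) (V : Pos d →ᵇ ℝ) (χ : SchwartzMap (Phase d) ℂ) (w : Phase d) : ℂ :=
  potentialDiff ε V w.1 w.2 * osc (fibre χ w.1) (-w.2)

/-- Over each `x`, `L_V` is a Fourier multiplier: transform in momentum, multiply by the bounded
symbol `δ[V](x, ·)`, transform back. -/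
lemma wignerOp_eq_osc (ε : ℝ) (V : Pos d →ᵇ ℝ) (χ : SchwartzMap (Phase d) ℂ) (w : Phase d) :
    wignerOp ε V χ w = (Complex.I / (2 * Real.pi : ℂ) ^ d) *
      osc (fun y => wignerSymbol ε V χ (w.1, y)) w.2 := by
  rw [wignerOp, osc]
  congr 2 with y
  rw [wignerSymbol, osc, ← integral_const_mul, ← integral_const_mul]
  congr 1 with p
  rw [inner_sub_right, sub_eq_add_neg, cis_add, inner_neg_left, real_inner_comm w.2 y, fibre_apply]
  simp only; ring

lemma stronglyMeasurable_osc_fibre_neg (χ : SchwartzMap (Phase d) ℂ) :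
    StronglyMeasurable fun w : Phase d => osc (fibre χ w.1) (-w.2) := by
  have := stronglyMeasurable_osc_fibre (F := χ) χ.continuous.stronglyMeasurable
  exact this.comp_measurable (g := fun w : Phase d => (w.1, -w.2)) (by fun_prop)

lemma stronglyMeasurable_wignerSymbol (ε : ℝ) (V : Pos d →ᵇ ℝ) (χ : SchwartzMap (Phase d) ℂ) :
    StronglyMeasurable (wignerSymbol ε V χ) :=
  (Complex.continuous_ofReal.comp (continuous_potentialDiff ε V)).stronglyMeasurable.mul
    (stronglyMeasurable_osc_fibre_neg χ)

lemma memLp_potentialDiff {ε : ℝ} (hε : 0 < ε) (V : Pos d →ᵇ ℝ) (x : Pos d) :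
    MemLp (fun y => (potentialDiff ε V x y : ℂ)) ⊤ volume :=
  memLp_top_of_bound (Complex.continuous_ofReal.comp ((continuous_potentialDiff ε V).comp
    (by fun_prop : Continuous fun y : Pos d => ((x, y) : Phase d)))).aestronglyMeasurable _
    (ae_of_all _ fun y => norm_potentialDiff_le hε V x y)

lemma integrable_wignerSymbol {ε : ℝ} (hε : 0 < ε) (V : Pos d →ᵇ ℝ) (χ : SchwartzMap (Phase d) ℂ)
    (x : Pos d) : Integrable fun y => wignerSymbol ε V χ (x, y) :=
  (integrable_osc_schwartz (fibre χ x)).comp_neg.bdd_mul (memLp_potentialDiff hε V x).1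
    (ae_of_all _ fun y => norm_potentialDiff_le hε V x y)

lemma memLp_wignerSymbol {ε : ℝ} (hε : 0 < ε) (V : Pos d →ᵇ ℝ) (χ : SchwartzMap (Phase d) ℂ)
    (x : Pos d) : MemLp (fun y => wignerSymbol ε V χ (x, y)) 2 :=
  MemLp.mul' (p := ⊤) (q := 2) ((memLp_osc_schwartz (fibre χ x)).comp_measurePreserving
    (Measure.measurePreserving_neg volume)) (memLp_potentialDiff hε V x)

lemma stronglyMeasurable_wignerOp (ε : ℝ) (V : Pos d →ᵇ ℝ) (χ : SchwartzMap (Phase d) ℂ) :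
    StronglyMeasurable (wignerOp ε V χ) := by
  rw [show wignerOp ε V χ = _ from funext (wignerOp_eq_osc ε V χ)]
  exact (stronglyMeasurable_osc_fibre (stronglyMeasurable_wignerSymbol ε V χ)).const_mul _

/-- The potential operator is bounded on `L²`. -/
lemma exists_lintegral_wignerOp_le {ε : ℝ} (hε : 0 < ε) (V : Pos d →ᵇ ℝ) :
    ∃ K : ℝ≥0∞, K ≠ ⊤ ∧ ∀ χ : SchwartzMap (Phase d) ℂ,
      ∫⁻ w, ‖wignerOp ε V χ w‖ₑ ^ 2 ≤ K * ∫⁻ w, ‖χ w‖ₑ ^ 2 := by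
  refine ⟨‖(Complex.I / (2 * Real.pi : ℂ) ^ d)‖ₑ ^ 2 * (ENNReal.ofReal ((2 * Real.pi) ^ d) *
    (ENNReal.ofReal (2 * ‖V‖ / ε) ^ 2 * ENNReal.ofReal ((2 * Real.pi) ^ d))),
    by finiteness, fun χ => ?_⟩
  simp only [wignerOp_eq_osc, enorm_mul, mul_pow]
  rw [lintegral_const_mul' _ _ (by finiteness), lintegral_osc_fibre
    (stronglyMeasurable_wignerSymbol ε V χ) (ae_of_all _ (integrable_wignerSymbol hε V χ))
    (ae_of_all _ (memLp_wignerSymbol hε V χ))]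
  -- Plancherel is used a second time, for the inner transform; between the two uses the symbol is
  -- estimated by its supremum `2 ‖V‖ / ε`.
  have h1 : ∫⁻ w : Phase d, ‖osc (fibre χ w.1) (-w.2)‖ₑ ^ 2 =
      ENNReal.ofReal ((2 * Real.pi) ^ d) * ∫⁻ w, ‖χ w‖ₑ ^ 2 := by
    rw [← lintegral_osc_fibre (F := χ) χ.continuous.stronglyMeasurable
      (ae_of_all _ fun x => (fibre χ x).integrable) (ae_of_all _ fun x => (fibre χ x).memLp 2 volume)]
    have hn : MeasurePreserving (fun w : Phase d => (w.1, -w.2)) :=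
      (MeasurePreserving.id (volume : Measure (Pos d))).prod (Measure.measurePreserving_neg volume)
    exact hn.lintegral_comp (f := fun w : Phase d => ‖osc (fun y => χ (w.1, y)) w.2‖ₑ ^ 2)
      ((stronglyMeasurable_osc_fibre χ.continuous.stronglyMeasurable).measurable.enorm.pow_const 2)
  have h2 : ∫⁻ w, ‖wignerSymbol ε V χ w‖ₑ ^ 2 ≤ ENNReal.ofReal (2 * ‖V‖ / ε) ^ 2 *
      (ENNReal.ofReal ((2 * Real.pi) ^ d) * ∫⁻ w, ‖χ w‖ₑ ^ 2) := by
    rw [← h1, ← lintegral_const_mul' _ _ (by finiteness)]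
    refine lintegral_mono fun w => ?_
    rw [wignerSymbol, enorm_mul, mul_pow]
    gcongr
    rw [← ofReal_norm]
    exact ENNReal.ofReal_le_ofReal (norm_potentialDiff_le hε V _ _)
  refine (mul_le_mul_right (mul_le_mul_right h2 _) _).trans_eq ?_
  simp only [mul_pow, mul_assoc]

lemma memLp_wignerOp {ε : ℝ} (hε : 0 < ε) (V : Pos d →ᵇ ℝ) (χ : SchwartzMap (Phase d) ℂ) :
    MemLp (wignerOp ε V χ) 2 := by
  rw [memLp_two_iff (stronglyMeasurable_wignerOp ε V χ).aestronglyMeasurable]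
  obtain ⟨K, hK, h⟩ := exists_lintegral_wignerOp_le hε V
  have h2 := (memLp_two_iff χ.continuous.aestronglyMeasurable).1 (χ.memLp 2 volume)
  exact (h χ).trans_lt (by finiteness)

lemma exists_norm_wignerOp_le {ε : ℝ} (hε : 0 < ε) (V : Pos d →ᵇ ℝ) :
    ∃ C : ℝ, 0 ≤ C ∧ ∀ χ : SchwartzMap (Phase d) ℂ,
      ‖(memLp_wignerOp hε V χ).toLp‖ ≤ C * ‖χ.toLp 2‖ := by
  obtain ⟨K, hK, h⟩ := exists_lintegral_wignerOp_le hε V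
  refine ⟨Real.sqrt K.toReal, Real.sqrt_nonneg _, fun χ => ?_⟩
  have h1 := h χ
  rw [← enorm_toLp_sq (memLp_wignerOp hε V χ), ← enorm_toLp_sq (χ.memLp 2 volume)] at h1
  have h2 := ENNReal.toReal_mono (by finiteness) h1
  simp only [ENNReal.toReal_mul, ENNReal.toReal_pow, toReal_enorm] at h2
  refine (pow_le_pow_iff_left₀ (norm_nonneg _) (by positivity) two_ne_zero).1 ?_
  refine h2.trans_eq ?_
  rw [mul_pow, Real.sq_sqrt ENNReal.toReal_nonneg]
  rfl

lemma quasiMeasurePreserving_affine {r : ℝ} (hr : r ≠ 0) (x : Pos d) :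
    Measure.QuasiMeasurePreserving (fun y : Pos d => x + r • y) volume volume := by
  refine (measurePreserving_add_left volume x).quasiMeasurePreserving.comp
    (f := fun y : Pos d => r • y) ⟨by fun_prop, ?_⟩
  rw [Measure.map_addHaar_smul _ hr]
  exact Measure.smul_absolutelyContinuous

/-- Each term multiplies the chord product by `V` at one endpoint. Conjugation in the second slot
flips the sign of `1/(iε)`, so the sum carries the factor `i δ[V]`. -/
lemma wignerTransform_potentialGen {ε : ℝ} (hε : 0 < ε) (V : Pos d →ᵇ ℝ) (φ ψ : WaveSpace d)
    (w : Phase d) :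
    wignerTransform ε (potentialGen ε V φ) ψ w + wignerTransform ε φ (potentialGen ε V ψ) w =
      (1 / (2 * Real.pi : ℂ) ^ d) *
        osc (fun y => Complex.I * potentialDiff ε V w.1 y * chordProduct ε φ ψ (w.1, y)) w.2 := by
  rw [wignerTransform_eq_osc, wignerTransform_eq_osc, ← mul_add, osc, osc, osc, ← integral_add]
  · congr 1
    refine integral_congr_ae ?_
    have h1 : ∀ φ : WaveSpace d, ∀ᵐ u, potentialGen ε V φ u = 1 / (Complex.I * ε) * (V u * φ u) :=
      coeFn_potentialGen ε V
    filter_upwards [(quasiMeasurePreserving_affine (r := -(ε / 2)) (by linarith) w.1).ae (h1 φ),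
      (quasiMeasurePreserving_affine (r := ε / 2) (by positivity) w.1).ae (h1 ψ)] with y h2 h3
    rw [neg_smul, ← sub_eq_add_neg] at h2
    simp only [chordProduct]
    rw [h2, h3, potentialDiff]
    have : (ε : ℂ) ≠ 0 := by exact_mod_cast hε.ne'
    simp only [map_mul, map_div₀, map_one, Complex.conj_I, Complex.conj_ofReal]
    push_cast
    field_simp
    ring_nf
    simp [Complex.I_sq]
    ring
  · exact (integrable_chordProduct hε _ _ _).bdd_mul (c := 1)
      (by fun_prop : Continuous fun y : Pos d => cis (inner ℝ w.2 y)).aestronglyMeasurable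
      (ae_of_all _ fun y => by simp)
  · exact (integrable_chordProduct hε _ _ _).bdd_mul (c := 1)
      (by fun_prop : Continuous fun y : Pos d => cis (inner ℝ w.2 y)).aestronglyMeasurable
      (ae_of_all _ fun y => by simp)

/-- Skew-symmetry of the potential operator on Wigner transforms. -/
lemma integral_wignerTransform_mul_wignerOp {ε : ℝ} (hε : 0 < ε) (V : Pos d →ᵇ ℝ)
    (φ ψ : WaveSpace d) (χ : SchwartzMap (Phase d) ℂ) :
    ∫ w, (wignerTransform ε (potentialGen ε V φ) ψ w +
      wignerTransform ε φ (potentialGen ε V ψ) w) * χ w =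
      -∫ w, wignerTransform ε φ ψ w * wignerOp ε V χ w := by
  have i1 : Integrable fun w => (wignerTransform ε (potentialGen ε V φ) ψ w +
      wignerTransform ε φ (potentialGen ε V ψ) w) * χ w :=
    integrable_mul_of_memLp ((memLp_wignerTransform hε _ _).add (memLp_wignerTransform hε _ _))
      (χ.memLp 2)
  have i2 : Integrable fun w => wignerTransform ε φ ψ w * wignerOp ε V χ w :=
    integrable_mul_of_memLp (memLp_wignerTransform hε _ _) (memLp_wignerOp hε V χ)
  rw [Measure.volume_eq_prod] at i1 i2 ⊢
  rw [integral_prod _ i1, integral_prod _ i2, ← integral_neg]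
  refine integral_congr_ae ?_
  filter_upwards [ae_memLp_chordProduct hε φ ψ] with x hx
  have hx1 := integrable_chordProduct hε φ ψ x
  simp only [wignerTransform_potentialGen hε, wignerTransform_eq_osc ε φ ψ, wignerOp_eq_osc]
  have e1 : ∀ k, (1 / (2 * Real.pi : ℂ) ^ d * osc (fun y => chordProduct ε φ ψ (x, y)) k) *
      (Complex.I / (2 * Real.pi : ℂ) ^ d * osc (fun y => wignerSymbol ε V χ (x, y)) k) =
      (Complex.I / ((2 * Real.pi : ℂ) ^ d * (2 * Real.pi : ℂ) ^ d)) *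
        (osc (fun y => chordProduct ε φ ψ (x, y)) k * osc (fun y => wignerSymbol ε V χ (x, y)) k) :=
    fun k => by field_simp
  simp only [e1]
  rw [integral_const_mul, integral_osc_mul_osc hx1 hx (integrable_wignerSymbol hε V χ x)
    (memLp_wignerSymbol hε V χ x)]
  simp only [mul_assoc]
  rw [integral_const_mul]
  have hI : Integrable fun y => Complex.I * (potentialDiff ε V x y * chordProduct ε φ ψ (x, y)) :=
    (hx1.bdd_mul (memLp_potentialDiff hε V x).1
      (ae_of_all _ fun y => norm_potentialDiff_le hε V x y)).const_mul _
  have := integral_osc_mul hI (fibre χ x).integrable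
  simp only [fibre_apply] at this
  rw [this, ← integral_neg_eq_self]
  simp only [wignerSymbol, potentialDiff_neg, ← integral_const_mul, ← integral_neg]
  congr 1 with y
  have : (2 * Real.pi : ℂ) ^ d ≠ 0 := pow_ne_zero _ (by simp [Real.pi_ne_zero])
  push_cast
  field_simp

end Operators

/-! ### Existence and uniqueness of Wigner solutions -/

section WignerSolutions

variable {d : ℕ}

/-- Undoing the free flow on the wave functions moves the Wigner transform by the shear, which
preserves measure and cancels against the shear of `c`. -/
lemma integral_wignerL2_backFlow {ε : ℝ} (hε : 0 < ε) (s : ℝ) (φ ψ : WaveSpace d)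
    (c : Phase d → ℂ) :
    ∫ w, wignerL2 hε (backFlow ε s φ) (backFlow ε s ψ) w * c (shear s w) =
      ∫ w, wignerL2 hε φ ψ w * c w := by
  have h1 : ∫ w, wignerL2 hε φ ψ w * c w = ∫ w, wignerTransform ε φ ψ w * c w :=
    integral_congr_ae ((coeFn_wignerL2 hε φ ψ).mono fun w hw => by simp only [hw])
  rw [h1, ← integral_comp_shear s fun w => wignerTransform ε φ ψ w * c w]
  refine integral_congr_ae ((coeFn_wignerL2 hε (backFlow ε s φ) (backFlow ε s ψ)).mono
    fun w hw => ?_)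
  simp only [hw, wignerTransform_backFlow hε, shear_apply]

/-- The Wigner transform of two Schrödinger solutions is a Wigner solution. -/
lemma isWignerSolution_wignerL2 {ε T : ℝ} (hε : 0 < ε) (hT : 0 < T) {V : Pos d →ᵇ ℝ}
    {φ ψ : ℝ → WaveSpace d} (hφ : IsSchrodingerSolution ε T V φ)
    (hψ : IsSchrodingerSolution ε T V ψ) :
    IsWignerSolution ε T V (fun t => wignerL2 hε (φ t) (ψ t)) where
  continuousOn :=
    ((wignerL2 hε).continuous.comp_continuousOn hφ.continuousOn).clm_apply hψ.continuousOn
  weak χ t ht := by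
    -- In the interaction picture `f` is differentiable in norm. The free transport sits in the test
    -- function `χ ∘ shear s`, whose derivative supplies the term `k · ∇ₓ χ`.
    set f : ℝ → PhaseSpaceL2 d := fun s =>
      wignerL2 hε (backFlow ε s (φ s)) (backFlow ε s (ψ s)) with hf
    have hfd := (wignerL2 hε).hasDerivWithinAt_of_bilinear (hφ.hasDerivWithinAt hε hT t ht)
      (hψ.hasDerivWithinAt hε hT t ht)
    have hχ : ∀ s, MemLp (fun w => χ (shear s w)) 2 := fun s => (shearComp s χ).memLp 2 volume
    obtain ⟨G, hG, hb⟩ := exists_memLp_bound_comp_shear (transportS χ) T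
    have hD : HasDerivWithinAt (fun s => ∫ w, f s w * χ (shear t w))
        (pairingL volume (wignerL2 hε (backFlow ε t (φ t)) (backFlow ε t (potentialGen ε V (ψ t))) +
          wignerL2 hε (backFlow ε t (potentialGen ε V (φ t))) (backFlow ε t (ψ t)))
          (hχ t).toLp) (Set.Icc 0 T) t := by
      simp only [← pairingL_toLp _ (hχ t)]
      exact (((pairingL volume).flip (hχ t).toLp).hasFDerivAt.restrictScalars
        ℝ).comp_hasDerivWithinAt t hfd
    have h := hasDerivWithinAt_integral_mul (convex_Icc 0 T) ht hfd.continuousWithinAt hχ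
      (fun s _ w => hasDerivAt_comp_shear χ w s) hG
      (fun s hs w => hb s (by rw [abs_of_nonneg hs.1]; exact hs.2) w) hD
    simp only [integral_wignerL2_backFlow hε] at h
    refine h.congr_deriv ?_
    rw [map_add, add_apply,
      pairingL_toLp, pairingL_toLp, integral_wignerL2_backFlow hε t _ _ χ,
      integral_wignerL2_backFlow hε t _ _ χ]
    have hW : ∀ (φ ψ : WaveSpace d) (c : Phase d → ℂ), ∫ w, wignerL2 hε φ ψ w * c w =
        ∫ w, wignerTransform ε φ ψ w * c w := fun φ ψ c =>
      integral_congr_ae ((coeFn_wignerL2 hε φ ψ).mono fun w hw => by simp only [hw])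
    have hm := memLp_wignerTransform hε (d := d)
    have h1 := integral_wignerTransform_mul_wignerOp hε V (φ t) (ψ t) χ
    simp only [add_mul] at h1
    rw [integral_add (integrable_mul_of_memLp (hm _ _) (χ.memLp 2))
      (integrable_mul_of_memLp (hm _ _) (χ.memLp 2))] at h1
    rw [hW, hW, hW, hW]
    simp only [mul_sub]
    rw [integral_sub (integrable_mul_of_memLp (hm _ _) ((transportS χ).memLp 2))
      (integrable_mul_of_memLp (hm _ _) (memLp_wignerOp hε V χ)), add_comm (∫ _, _), h1]
    ring

/-- Schwartz functions are dense in `L²`, so the bound passes to all test vectors; the choice `star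
h` recovers `‖h‖²`. -/
lemma norm_le_of_forall_schwartz (h : PhaseSpaceL2 d) {M : ℝ} (h0 : 0 ≤ M)
    (hM : ∀ χ : SchwartzMap (Phase d) ℂ, ‖∫ w, h w * χ w‖ ≤ M * ‖χ.toLp 2‖) : ‖h‖ ≤ M := by
  have h1 : ∀ g : PhaseSpaceL2 d, ‖pairingL volume h g‖ ≤ M * ‖g‖ := by
    intro g
    refine (SchwartzMap.denseRange_toLpCLM (E := Phase d) (F := ℂ) (p := 2) (μ := volume)
      ENNReal.ofNat_ne_top).induction_on g (isClosed_le (by fun_prop) (by fun_prop)) fun χ => ?_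
    have := hM χ
    rwa [← pairingL_toLp h (χ.memLp 2 volume)] at this
  have h2 : pairingL volume h (star h) = inner ℂ h h := by
    rw [pairingL_apply, L2.inner_def]
    refine integral_congr_ae ?_
    filter_upwards [Lp.coeFn_star h] with x hx
    rw [hx, RCLike.inner_apply]; rfl
  have h3 := h1 (star h)
  rw [h2, inner_self_eq_norm_sq_to_K, norm_star_Lp] at h3
  rcases eq_or_ne h 0 with rfl | hne
  · rwa [norm_zero]
  · have h4 : 0 < ‖h‖ := norm_pos_iff.2 hne
    have h5 : ‖h‖ * ‖h‖ ≤ M * ‖h‖ := by simpa [sq] using h3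
    exact le_of_mul_le_mul_right h5 h4

/-- The scalar functions of time by which the difference of two Wigner solutions is controlled. -/
lemma hasDerivWithinAt_sub_comp_shear {ε T : ℝ} (hε : 0 < ε) {V : Pos d →ᵇ ℝ}
    {f g : ℝ → PhaseSpaceL2 d} (hf : IsWignerSolution ε T V f) (hg : IsWignerSolution ε T V g)
    (χ : SchwartzMap (Phase d) ℂ) {t : ℝ} (ht : t ∈ Set.Icc 0 T) :
    HasDerivWithinAt (fun s => ∫ w, (f s - g s) w * χ (shear (-s) w))
      (-∫ w, (f t - g t) w * wignerOp ε V (shearComp (-t) χ) w) (Set.Icc 0 T) t := by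
  have hχ : ∀ s, MemLp (fun w => χ (shear (-s) w)) 2 := fun s => (shearComp (-s) χ).memLp 2 volume
  have hT := (transportS (shearComp (-t) χ)).memLp 2 volume
  have hO := memLp_wignerOp hε V (shearComp (-t) χ)
  obtain ⟨G, hG, hb⟩ := exists_memLp_bound_comp_shear (transportS χ) T
  have hD : HasDerivWithinAt (fun s => ∫ w, (f s - g s) w * χ (shear (-t) w))
      (∫ w, (f t - g t) w *
        (transport (shearComp (-t) χ) w - wignerOp ε V (shearComp (-t) χ) w)) (Set.Icc 0 T) t := by
    have h1 := (hf.weak (shearComp (-t) χ) t ht).sub (hg.weak (shearComp (-t) χ) t ht)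
    have e1 : ∀ s (c : Phase d → ℂ), MemLp c 2 → ∫ w, (f s - g s) w * c w =
        (∫ w, f s w * c w) - ∫ w, g s w * c w := fun s c hc => by
      simp only [← pairingL_toLp _ hc, map_sub, sub_apply]
    have hTO : MemLp (fun w => transport (shearComp (-t) χ) w -
      wignerOp ε V (shearComp (-t) χ) w) 2 := hT.sub hO
    rw [e1 t _ hTO]
    simp only [e1 _ _ (hχ t)]
    exact h1
  -- The test function is carried along the characteristics, so its time derivative cancels the
  -- unbounded transport term and leaves only `L_V`.
  have h := hasDerivWithinAt_integral_mul (convex_Icc 0 T) ht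
    ((hf.continuousOn.sub hg.continuousOn) t ht) hχ
    (c' := fun s w => -transport χ (shear (-s) w))
    (fun s _ w => by
      have h1 := (hasDerivAt_comp_shear χ w (-s)).scomp s (hasDerivAt_neg s)
      rw [neg_smul, one_smul] at h1
      exact h1) hG
    (fun s hs w => by
      rw [norm_neg]; exact hb (-s) (by rw [abs_neg, abs_of_nonneg hs.1]; exact hs.2) w) hD
  refine h.congr_deriv ?_
  have i1 : Integrable fun w => (f t - g t) w * transport (shearComp (-t) χ) w :=
    integrable_mul_of_memLp (Lp.memLp _) hT
  have i2 : Integrable fun w => (f t - g t) w * wignerOp ε V (shearComp (-t) χ) w :=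
    integrable_mul_of_memLp (Lp.memLp _) hO
  simp only [mul_sub, mul_neg, ← transport_shearComp]
  rw [integral_neg, integral_sub i1 i2]
  simp only [Pi.sub_apply]
  ring

/-- The constant is uniform in `s` because shearing a test function preserves its `L²` norm. -/
lemma norm_integral_mul_wignerOp_le {ε : ℝ} (hε : 0 < ε) (V : Pos d →ᵇ ℝ) :
    ∃ C : ℝ, 0 ≤ C ∧ ∀ (h : PhaseSpaceL2 d) (s : ℝ) (χ : SchwartzMap (Phase d) ℂ),
      ‖-∫ w, h w * wignerOp ε V (shearComp s χ) w‖ ≤ C * ‖χ.toLp 2‖ * ‖h‖ := by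
  obtain ⟨C, hC, hb⟩ := exists_norm_wignerOp_le hε V
  refine ⟨C, hC, fun h s χ => ?_⟩
  rw [norm_neg, ← pairingL_toLp h (memLp_wignerOp hε V (shearComp s χ)), mul_comm]
  refine (norm_pairingL_le _ _).trans (mul_le_mul_of_nonneg_left ?_ (norm_nonneg _))
  rw [← norm_toLp_shearComp s χ]
  exact hb _

lemma norm_sub_le_of_forall_schwartz (h : PhaseSpaceL2 d) (t : ℝ) {M : ℝ} (h0 : 0 ≤ M)
    (hM : ∀ χ : SchwartzMap (Phase d) ℂ, ‖∫ w, h w * χ (shear (-t) w)‖ ≤ M * ‖χ.toLp 2‖) :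
    ‖h‖ ≤ M := by
  refine norm_le_of_forall_schwartz h h0 fun χ => ?_
  have := hM (shearComp t χ)
  simpa only [shearComp_apply, shear_shear_neg, norm_toLp_shearComp] using this

/-- The Grönwall argument runs over the family of all Schwartz functions at once, with weights `N`
their `L²` norms, so that duality returns the norm of the difference. -/
lemma IsWignerSolution.eqOn_of_initial {ε T : ℝ} (hε : 0 < ε) (hT : 0 < T) {V : Pos d →ᵇ ℝ}
    {f g : ℝ → PhaseSpaceL2 d} (hf : IsWignerSolution ε T V f) (hg : IsWignerSolution ε T V g)
    (h0 : f 0 = g 0) : Set.EqOn f g (Set.Icc 0 T) := by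
  obtain ⟨C, hC, hb⟩ := norm_integral_mul_wignerOp_le hε V
  have hp0 : ∀ χ : SchwartzMap (Phase d) ℂ, ∫ w, (f 0 - g 0) w * χ (shear (-0) w) = 0 := by
    intro χ
    simp [h0]
  have := eq_zero_of_weak_gronwall (h := fun s => f s - g s) hT hC
    (hf.continuousOn.sub hg.continuousOn)
    (p := fun (χ : SchwartzMap (Phase d) ℂ) s => ∫ w, (f s - g s) w * χ (shear (-s) w))
    (fun χ t ht => hasDerivWithinAt_sub_comp_shear hε hf hg χ ht)
    (N := fun χ => ‖χ.toLp 2 volume‖) (fun χ t _ => hb (f t - g t) (-t) χ)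
    (fun t _ M hM h => norm_sub_le_of_forall_schwartz (f t - g t) t hM h) hp0
  exact fun t ht => sub_eq_zero.1 (this t ht)

lemma IsWignerSolution.eqOn_of_final {ε T : ℝ} (hε : 0 < ε) (hT : 0 < T) {V : Pos d →ᵇ ℝ}
    {f g : ℝ → PhaseSpaceL2 d} (hf : IsWignerSolution ε T V f) (hg : IsWignerSolution ε T V g)
    (h0 : f T = g T) : Set.EqOn f g (Set.Icc 0 T) := by
  obtain ⟨C, hC, hb⟩ := norm_integral_mul_wignerOp_le hε V
  have hp0 : ∀ χ : SchwartzMap (Phase d) ℂ, ∫ w, (f T - g T) w * χ (shear (-T) w) = 0 := by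
    intro χ
    simp [h0]
  have := eq_zero_of_weak_gronwall_final (h := fun s => f s - g s) hT hC
    (hf.continuousOn.sub hg.continuousOn)
    (p := fun (χ : SchwartzMap (Phase d) ℂ) s => ∫ w, (f s - g s) w * χ (shear (-s) w))
    (fun χ t ht => hasDerivWithinAt_sub_comp_shear hε hf hg χ ht)
    (N := fun χ => ‖χ.toLp 2 volume‖) (fun χ t _ => hb (f t - g t) (-t) χ)
    (fun t _ M hM h => norm_sub_le_of_forall_schwartz (f t - g t) t hM h) hp0
  exact fun t ht => sub_eq_zero.1 (this t ht)

end WignerSolutions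

/-! ### Products of wave functions and their Fourier transforms -/

section Products

variable {d : ℕ}

/-- Integration of an integrable function against a bounded one. -/
def boundedPairing {c : Pos d → ℂ} (hc : MemLp c ⊤) :
    Lp ℂ 1 (volume : Measure (Pos d)) →L[ℂ] ℂ :=
  ((ContinuousLinearMap.mul ℂ ℂ).lpPairing volume 1 ⊤).flip hc.toLp

lemma boundedPairing_apply {c : Pos d → ℂ} (hc : MemLp c ⊤)
    (h : Lp ℂ 1 (volume : Measure (Pos d))) : boundedPairing hc h = ∫ x, h x * c x := by
  rw [boundedPairing, ContinuousLinearMap.flip_apply, ContinuousLinearMap.lpPairing_eq_integral]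
  exact integral_congr_ae (hc.coeFn_toLp.mono fun x hx => by simp [hx])

lemma memLp_cis (p : Pos d) : MemLp (fun x : Pos d => cis (inner ℝ p x)) ⊤ :=
  memLp_top_of_bound
    (by fun_prop : Continuous fun x : Pos d => cis (inner ℝ p x)).aestronglyMeasurable 1
    (ae_of_all _ fun x => by simp)

/-- As a continuous linear functional on `L¹`, the Fourier integral at a point commutes with the
Bochner integral in time. -/
lemma osc_eq_boundedPairing (h : Lp ℂ 1 (volume : Measure (Pos d))) (p : Pos d) :
    osc h p = boundedPairing (memLp_cis p) h := by
  rw [boundedPairing_apply, osc]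
  simp only [mul_comm]

lemma toDistribution_eq_boundedPairing (h : Lp ℂ 1 (volume : Measure (Pos d)))
    (χ : SchwartzMap (Pos d) ℂ) :
    toDistribution h χ = boundedPairing (χ.memLp_top volume) h :=
  (boundedPairing_apply _ _).symm

lemma coeFn_mulConj (φ ψ : WaveSpace d) :
    mulConj φ ψ =ᵐ[volume] fun x => φ x * conj (ψ x) :=
  Integrable.coeFn_toL1 _

lemma mulConj_eq_holder (φ ψ : WaveSpace d) :
    mulConj φ ψ = (ContinuousLinearMap.mul ℂ ℂ).holderL volume 2 2 1 φ (star ψ) := by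
  refine Lp.ext ?_
  filter_upwards [coeFn_mulConj φ ψ, Lp.coeFn_star ψ,
    (ContinuousLinearMap.mul ℂ ℂ).coeFn_holder (r := 1) φ (star ψ)] with x h1 h2 h3
  rw [h1, ContinuousLinearMap.holderL_apply_apply, h3, h2]
  rfl

lemma continuousOn_mulConj {s : Set ℝ} {φ ψ : ℝ → WaveSpace d} (hφ : ContinuousOn φ s)
    (hψ : ContinuousOn ψ s) : ContinuousOn (fun t => mulConj (φ t) (ψ t)) s := by
  have hs : Continuous fun f : WaveSpace d => star f := by
    refine (LipschitzWith.of_dist_le_mul (K := 1) fun f g => ?_).continuous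
    rw [dist_eq_norm, dist_eq_norm, NNReal.coe_one, one_mul]
    refine Lp.norm_le_norm_of_ae_le ?_
    filter_upwards [Lp.coeFn_sub (star f) (star g), Lp.coeFn_sub f g, Lp.coeFn_star f,
      Lp.coeFn_star g] with x h1 h2 h3 h4
    rw [h1, h2, Pi.sub_apply, Pi.sub_apply, h3, h4, Pi.star_apply, Pi.star_apply, ← star_sub,
      norm_star]
  simp only [mulConj_eq_holder]
  exact (((ContinuousLinearMap.mul ℂ ℂ).holderL volume 2 2 1).continuous.comp_continuousOn
    hφ).clm_apply (hs.comp_continuousOn hψ)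

lemma integral_mulConj (φ ψ : WaveSpace d) : ∫ x, φ x * conj (ψ x) = inner ℂ ψ φ := by
  rw [L2.inner_def]
  simp only [RCLike.inner_apply]

lemma osc_mulConj (φ ψ : WaveSpace d) (p : Pos d) :
    osc (mulConj φ ψ) p = ∫ x, cis (inner ℝ p x) * (φ x * conj (ψ x)) :=
  integral_congr_ae ((coeFn_mulConj φ ψ).mono fun x hx => by simp only [hx])

lemma measurePreserving_translate_snd (q : Pos d) :
    MeasurePreserving (fun w : Phase d => (w.1, w.2 + q)) :=
  (MeasurePreserving.id (volume : Measure (Pos d))).prod (measurePreserving_add_right volume q)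

lemma integrable_wignerTransform_mul_shift {ε : ℝ} (hε : 0 < ε) (ψ₁ ψ₂ φ₁ φ₂ : WaveSpace d)
    (p q : Pos d) :
    Integrable fun w : Phase d => cis (inner ℝ p w.1) * conj (wignerTransform ε ψ₁ ψ₂ w) *
      wignerTransform ε φ₁ φ₂ (w.1, w.2 + q) := by
  simp only [mul_assoc]
  exact (integrable_mul_of_memLp (memLp_conj (memLp_wignerTransform hε ψ₁ ψ₂))
    ((memLp_wignerTransform hε φ₁ φ₂).comp_measurePreserving
      (measurePreserving_translate_snd q))).bdd_mul (c := 1)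
    (by fun_prop : Continuous fun w : Phase d => cis (inner ℝ p w.1)).aestronglyMeasurable
    (ae_of_all _ fun w => by simp)

/-- The integral over `(x, k)` in the Wigner representative, in terms of the chord products. -/
lemma integral_conj_wignerTransform_mul {ε : ℝ} (hε : 0 < ε) (ψ₁ ψ₂ φ₁ φ₂ : WaveSpace d)
    (p q : Pos d) :
    ∫ w : Phase d, cis (inner ℝ p w.1) * conj (wignerTransform ε ψ₁ ψ₂ w) *
        wignerTransform ε φ₁ φ₂ (w.1, w.2 + q) =
      (1 / (2 * Real.pi : ℂ) ^ d) * ∫ w : Phase d, cis (inner ℝ p w.1 + inner ℝ q w.2) *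
        (conj (chordProduct ε ψ₁ ψ₂ w) * chordProduct ε φ₁ φ₂ w) := by
  have hm : ∀ φ ψ : WaveSpace d, MemLp (chordProduct ε φ ψ) 2 := fun φ ψ =>
    (memLp_two_iff (stronglyMeasurable_chordProduct ε φ ψ).aestronglyMeasurable).2 <| by
      rw [lintegral_chordProduct hε]; finiteness
  have i1 := integrable_wignerTransform_mul_shift hε ψ₁ ψ₂ φ₁ φ₂ p q
  have i2 : Integrable fun w : Phase d => cis (inner ℝ p w.1 + inner ℝ q w.2) *
        (conj (chordProduct ε ψ₁ ψ₂ w) * chordProduct ε φ₁ φ₂ w) :=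
    (integrable_mul_of_memLp (memLp_conj (hm ψ₁ ψ₂)) (hm φ₁ φ₂)).bdd_mul (c := 1)
      (by fun_prop : Continuous fun w : Phase d =>
        cis (inner ℝ p w.1 + inner ℝ q w.2)).aestronglyMeasurable (ae_of_all _ fun w => by simp)
  rw [Measure.volume_eq_prod] at i1 i2 ⊢
  rw [integral_prod _ i1, integral_prod _ i2, ← integral_const_mul]
  refine integral_congr_ae ?_
  filter_upwards [ae_memLp_chordProduct hε φ₁ φ₂, ae_memLp_chordProduct hε ψ₁ ψ₂] with x h1 h2
  have j1 := integrable_chordProduct hε φ₁ φ₂ x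
  have hc : Continuous fun y : Pos d => cis (inner ℝ q y) := by fun_prop
  have j2 : Integrable fun y => cis (inner ℝ q y) * chordProduct ε φ₁ φ₂ (x, y) :=
    j1.bdd_mul (c := 1) hc.aestronglyMeasurable (ae_of_all _ fun w => by simp)
  have h3 : MemLp (fun y => cis (inner ℝ q y) * chordProduct ε φ₁ φ₂ (x, y)) 2 :=
    MemLp.mul' (p := ⊤) (q := 2) h1 (memLp_cis q)
  have key := integral_conj_osc_mul_osc (integrable_chordProduct hε ψ₁ ψ₂ x) h2 j2 h3
  -- A shift by `q` in `k` is a modulation by `e^{i q·y}` in `y`, which turns the fibre integral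
  -- into an instance of Parseval.
  have e : ∀ k, osc (fun y => chordProduct ε φ₁ φ₂ (x, y)) (k + q) =
      osc (fun y => cis (inner ℝ q y) * chordProduct ε φ₁ φ₂ (x, y)) k := by
    intro k
    simp only [osc, inner_add_left, cis_add, mul_assoc]
  simp only [wignerTransform_eq_osc, e, cis_add, mul_assoc, map_mul]
  rw [integral_const_mul (cis (inner ℝ p x)), integral_const_mul (cis (inner ℝ p x))]
  have hπ : (2 * Real.pi : ℂ) ^ d ≠ 0 := pow_ne_zero _ (by simp [Real.pi_ne_zero])
  have e2 : ∀ k, conj (1 / (2 * Real.pi : ℂ) ^ d) *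
      (conj (osc (fun y => chordProduct ε ψ₁ ψ₂ (x, y)) k) * (1 / (2 * Real.pi : ℂ) ^ d *
        osc (fun y => cis (inner ℝ q y) * chordProduct ε φ₁ φ₂ (x, y)) k)) =
      (1 / ((2 * Real.pi : ℂ) ^ d * (2 * Real.pi : ℂ) ^ d)) *
      (conj (osc (fun y => chordProduct ε ψ₁ ψ₂ (x, y)) k) *
        osc (fun y => cis (inner ℝ q y) * chordProduct ε φ₁ φ₂ (x, y)) k) := by
    intro k
    simp only [map_div₀, map_one, map_pow, map_mul, Complex.conj_ofReal, map_ofNat]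
    field_simp
  simp only [e2]
  rw [integral_const_mul, key]
  simp only [mul_left_comm (conj _) (cis _)]
  field_simp

/-- The phase is `p · (x + (ε/2) y)`, a function of the second endpoint alone. In endpoint
coordinates the integrand is a product, so the first endpoint contributes an inner product and the
second a Fourier integral. -/
lemma integral_chordProduct_cis {ε : ℝ} (hε : 0 < ε) (ψ₁ ψ₂ φ₁ φ₂ : WaveSpace d) (p : Pos d) :
    ∫ w : Phase d, cis (inner ℝ p w.1 + inner ℝ ((ε / 2) • p) w.2) *
        (conj (chordProduct ε ψ₁ ψ₂ w) * chordProduct ε φ₁ φ₂ w) =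
      ((ε : ℂ) ^ d)⁻¹ * (inner ℂ ψ₁ φ₁ * osc (mulConj ψ₂ φ₂) p) := by
  have hm : ∀ φ : WaveSpace d, Measurable φ := fun φ => (Lp.stronglyMeasurable φ).measurable
  have h := integral_comp_chord hε (f := fun w : Phase d => (φ₁ w.1 * conj (ψ₁ w.1)) *
    (cis (inner ℝ p w.2) * (ψ₂ w.2 * conj (φ₂ w.2))))
    (by
      have := hm φ₁; have := hm φ₂; have := hm ψ₁; have := hm ψ₂
      have hc : Measurable (conj : ℂ → ℂ) := Complex.continuous_conj.measurable
      exact Measurable.aestronglyMeasurable (by fun_prop))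
  rw [Measure.volume_eq_prod, integral_prod_mul (fun x => φ₁ x * conj (ψ₁ x))
    (fun x => cis (inner ℝ p x) * (ψ₂ x * conj (φ₂ x))), integral_mulConj, ← osc_mulConj] at h
  rw [← h, Measure.volume_eq_prod]
  congr 1 with w
  simp only [chord, chordProduct, inner_add_right, inner_smul_right, inner_smul_left, map_mul,
    Complex.conj_conj, conj_trivial]
  ring

/-- With the opposite shift the phase sits on the first endpoint and the two roles are exchanged. -/
lemma integral_chordProduct_cis_neg {ε : ℝ} (hε : 0 < ε) (ψ₁ ψ₂ φ₁ φ₂ : WaveSpace d) (p : Pos d) :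
    ∫ w : Phase d, cis (inner ℝ p w.1 + inner ℝ (-((ε / 2) • p)) w.2) *
        (conj (chordProduct ε ψ₁ ψ₂ w) * chordProduct ε φ₁ φ₂ w) =
      ((ε : ℂ) ^ d)⁻¹ * (osc (mulConj φ₁ ψ₁) p * inner ℂ φ₂ ψ₂) := by
  have hm : ∀ φ : WaveSpace d, Measurable φ := fun φ => (Lp.stronglyMeasurable φ).measurable
  have h := integral_comp_chord hε (f := fun w : Phase d =>
    (cis (inner ℝ p w.1) * (φ₁ w.1 * conj (ψ₁ w.1))) * (ψ₂ w.2 * conj (φ₂ w.2)))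
    (by
      have := hm φ₁; have := hm φ₂; have := hm ψ₁; have := hm ψ₂
      have hc : Measurable (conj : ℂ → ℂ) := Complex.continuous_conj.measurable
      exact Measurable.aestronglyMeasurable (by fun_prop))
  rw [Measure.volume_eq_prod, integral_prod_mul (fun x => cis (inner ℝ p x) * (φ₁ x * conj (ψ₁ x)))
    (fun x => ψ₂ x * conj (φ₂ x)), integral_mulConj, ← osc_mulConj] at h
  rw [← h, Measure.volume_eq_prod]
  congr 1 with w
  simp only [chord, chordProduct, inner_sub_right, inner_smul_right, inner_neg_left,
    inner_smul_left, map_mul, Complex.conj_conj, conj_trivial, ← sub_eq_add_neg]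
  ring

/-- The phase space integral in the Wigner representative for Wigner transforms. -/
lemma integral_cis_mul_phaseDiff {ε : ℝ} (hε : 0 < ε) (ψ₁ ψ₂ φ₁ φ₂ : WaveSpace d) (p : Pos d) :
    ∫ w : Phase d, cis (inner ℝ p w.1) * conj (wignerL2 hε ψ₁ ψ₂ w) *
        phaseDiff ε (wignerL2 hε φ₁ φ₂) w.1 w.2 p =
      (1 / (ε * (2 * Real.pi * ε : ℂ) ^ d)) *
        osc ((inner ℂ ψ₁ φ₁ : ℂ) • mulConj ψ₂ φ₂ - (inner ℂ φ₂ ψ₂ : ℂ) • mulConj φ₁ ψ₁ :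
          Lp ℂ 1 (volume : Measure (Pos d))) p := by
  -- `phaseDiff` evaluates `L²` representatives at shifted points; translations preserve null sets,
  -- so these values may be replaced by the Wigner transform almost everywhere.
  have e1 : ∀ᵐ w : Phase d, cis (inner ℝ p w.1) * conj (wignerL2 hε ψ₁ ψ₂ w) *
      phaseDiff ε (wignerL2 hε φ₁ φ₂) w.1 w.2 p = (1 / (ε : ℂ)) *
      (cis (inner ℝ p w.1) * conj (wignerTransform ε ψ₁ ψ₂ w) *
        wignerTransform ε φ₁ φ₂ (w.1, w.2 + (ε / 2) • p) -
       cis (inner ℝ p w.1) * conj (wignerTransform ε ψ₁ ψ₂ w) *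
        wignerTransform ε φ₁ φ₂ (w.1, w.2 + -((ε / 2) • p))) := by
    filter_upwards [coeFn_wignerL2 hε ψ₁ ψ₂,
      (measurePreserving_translate_snd ((ε / 2) • p)).quasiMeasurePreserving.ae (coeFn_wignerL2 hε φ₁ φ₂),
      (measurePreserving_translate_snd (-((ε / 2) • p))).quasiMeasurePreserving.ae (coeFn_wignerL2 hε φ₁ φ₂)] with w h1 h2 h3
    rw [phaseDiff, sub_eq_add_neg w.2, h1, h2, h3]
    ring
  rw [integral_congr_ae e1, integral_const_mul,
    integral_sub (integrable_wignerTransform_mul_shift hε _ _ _ _ _ _)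
      (integrable_wignerTransform_mul_shift hε _ _ _ _ _ _),
    integral_conj_wignerTransform_mul hε, integral_conj_wignerTransform_mul hε,
    integral_chordProduct_cis hε, integral_chordProduct_cis_neg hε]
  simp only [osc_eq_boundedPairing, map_sub, map_smul, smul_eq_mul, mul_pow]
  have : (ε : ℂ) ≠ 0 := by exact_mod_cast hε.ne'
  have : (Real.pi : ℂ) ≠ 0 := by simp [Real.pi_ne_zero]
  field_simp

end Products

/-! ### The Wigner representative of Wigner transforms -/

section Representatives

variable {d : ℕ}

/-- The point `x` enters only through a unimodular factor, so integrability in `p` can be tested at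
`x = 0`. -/
lemma wignerRepIntegrand_eq_mul (ε T : ℝ) (f g : ℝ → PhaseSpaceL2 d) (x p : Pos d) :
    wignerRepIntegrand ε T f g x p = cis (-inner ℝ p x) * wignerRepIntegrand ε T f g 0 p := by
  rw [wignerRepIntegrand, wignerRepIntegrand, ← intervalIntegral.integral_const_mul]
  congr 1 with t
  rw [← integral_const_mul]
  congr 1 with w
  rw [sub_zero, inner_sub_right, sub_eq_add_neg, cis_add]
  ring

lemma wignerRep_eq (ε T : ℝ) (f g : ℝ → PhaseSpaceL2 d) (χ : SchwartzMap (Pos d) ℂ) :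
    wignerRep ε T f g χ = (Complex.I / (2 * Real.pi : ℂ) ^ d) *
      ∫ p, osc χ (-p) * wignerRepIntegrand ε T f g 0 p := by
  rw [wignerRep]
  congr 2 with p
  rw [wignerRepIntegrand, ← intervalIntegral.integral_const_mul]
  congr 1 with t
  rw [← integral_const_mul]
  congr 1 with w
  have : ∫ x : Pos d, cis (inner ℝ p (w.1 - x)) * χ x = cis (inner ℝ p w.1) * osc χ (-p) := by
    rw [osc, ← integral_const_mul]
    congr 1 with x
    rw [inner_sub_right, sub_eq_add_neg, cis_add, inner_neg_left, mul_assoc]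
  rw [this, sub_zero]
  ring

lemma wignerRepAt_eq (ε T : ℝ) (f g : ℝ → PhaseSpaceL2 d) (x : Pos d) :
    wignerRepAt ε T f g x = (Complex.I / (2 * Real.pi : ℂ) ^ d) *
      osc (wignerRepIntegrand ε T f g 0) (-x) := by
  rw [wignerRepAt, osc]
  congr 2 with p
  rw [wignerRepIntegrand_eq_mul, inner_neg_left, real_inner_comm]

lemma continuous_osc {f : Pos d → ℂ} (hf : Integrable f) : Continuous (osc f) := by
  have hc : Continuous (𝓕⁻ f) := VectorFourier.fourierIntegral_continuous
    Real.continuous_fourierChar (continuous_inner (𝕜 := ℝ) (E := Pos d)).neg hf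
  rw [show osc f = fun k => 𝓕⁻ f ((2 * Real.pi)⁻¹ • k) from funext (osc_eq_fourierInv f)]
  fun_prop

lemma integral_wignerRepAt_mul {ε T : ℝ} {f g : ℝ → PhaseSpaceL2 d}
    (h : Integrable (wignerRepIntegrand ε T f g 0)) (χ : SchwartzMap (Pos d) ℂ) :
    ∫ x, wignerRepAt ε T f g x * χ x = wignerRep ε T f g χ := by
  simp only [wignerRepAt_eq, wignerRep_eq, mul_assoc]
  rw [integral_const_mul, ← integral_neg_eq_self]
  simp only [neg_neg]
  rw [integral_osc_mul h χ.integrable.comp_neg]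
  congr 2 with p
  rw [mul_comm]
  congr 1
  rw [osc, osc, ← integral_neg_eq_self]
  simp

/-- Fubini moves the Fourier integral from `H` to `χ`, and inversion is applied to the Schwartz
function `χ`. No integrability of `osc H` is needed. -/
lemma wignerRep_of_integrand_eq {ε T : ℝ} {f g : ℝ → PhaseSpaceL2 d} {K : ℂ}
    {H : Lp ℂ 1 (volume : Measure (Pos d))}
    (h : ∀ p, wignerRepIntegrand ε T f g 0 p = K * osc H p) (χ : SchwartzMap (Pos d) ℂ) :
    wignerRep ε T f g χ = Complex.I * K * toDistribution H χ := by
  have hi : Integrable fun p => osc χ (-p) := (integrable_osc_schwartz χ).comp_neg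
  simp only [wignerRep_eq, h, mul_left_comm _ K]
  rw [integral_const_mul]
  simp only [mul_comm (osc χ _)]
  rw [integral_osc_mul (L1.integrable_coeFn H) hi]
  simp only [osc_osc, mul_left_comm _ ((2 * Real.pi : ℂ) ^ d)]
  rw [integral_const_mul, toDistribution]
  have : (2 * Real.pi : ℂ) ^ d ≠ 0 := pow_ne_zero _ (by simp [Real.pi_ne_zero])
  field_simp

/-- The difference of products of wave functions to which the Wigner representative reduces. -/
def crossDiff (φ φ' ψ ψ' : ℝ → WaveSpace d) (T : ℝ) : Lp ℂ 1 (volume : Measure (Pos d)) :=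
  (inner ℂ (ψ 0) (φ 0) : ℂ) • (∫ t in (0 : ℝ)..T, mulConj (φ' t) (ψ' t)) -
    (inner ℂ (ψ' 0) (φ' 0) : ℂ) • ∫ t in (0 : ℝ)..T, mulConj (φ t) (ψ t)

/-- The weights at time `t` are inner products of Schrödinger solutions; by conservation they equal
their values at time `0` and come out of the time integral. -/
lemma wignerRepIntegrand_zero {ε T : ℝ} (hε : 0 < ε) (hT : 0 < T) {V : Pos d →ᵇ ℝ}
    {φ φ' ψ ψ' : ℝ → WaveSpace d} (hφ : IsSchrodingerSolution ε T V φ)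
    (hφ' : IsSchrodingerSolution ε T V φ') (hψ : IsSchrodingerSolution ε T V ψ)
    (hψ' : IsSchrodingerSolution ε T V ψ') {f g : ℝ → PhaseSpaceL2 d}
    (hf : Set.EqOn f (fun t => wignerL2 hε (φ t) (ψ' t)) (Set.Icc 0 T))
    (hg : Set.EqOn g (fun t => wignerL2 hε (ψ t) (φ' t)) (Set.Icc 0 T)) (p : Pos d) :
    wignerRepIntegrand ε T f g 0 p =
      (1 / (ε * (2 * Real.pi * ε : ℂ) ^ d)) * osc (crossDiff φ φ' ψ ψ' T) p := by
  have hi : ∀ {φ ψ : ℝ → WaveSpace d} (c : ℂ), IsSchrodingerSolution ε T V φ →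
      IsSchrodingerSolution ε T V ψ →
      IntervalIntegrable (fun t => c • mulConj (φ t) (ψ t)) volume 0 T := fun c h₁ h₂ =>
    ContinuousOn.intervalIntegrable (by
      rw [Set.uIcc_of_le hT.le]
      exact (continuousOn_mulConj h₁.continuousOn h₂.continuousOn).const_smul c)
  have e : ∀ t ∈ Set.uIcc 0 T, (∫ w : Phase d, cis (inner ℝ p (w.1 - 0)) * conj (g t w) *
      phaseDiff ε (f t) w.1 w.2 p) = (1 / (ε * (2 * Real.pi * ε : ℂ) ^ d)) *
        boundedPairing (memLp_cis p) ((inner ℂ (ψ 0) (φ 0) : ℂ) • mulConj (φ' t) (ψ' t) -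
          (inner ℂ (ψ' 0) (φ' 0) : ℂ) • mulConj (φ t) (ψ t)) := by
    intro t ht
    rw [Set.uIcc_of_le hT.le] at ht
    rw [← osc_eq_boundedPairing, ← hφ.inner_eq hε hT hψ t ht, ← hφ'.inner_eq hε hT hψ' t ht,
      ← integral_cis_mul_phaseDiff hε, hf ht, hg ht]
    simp only [sub_zero]
  rw [wignerRepIntegrand, intervalIntegral.integral_congr e, intervalIntegral.integral_const_mul,
    ContinuousLinearMap.intervalIntegral_comp_comm _
      ((hi _ hφ' hψ').sub (hi _ hφ hψ)),
    intervalIntegral.integral_sub (hi _ hφ' hψ') (hi _ hφ hψ),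
    intervalIntegral.integral_smul, intervalIntegral.integral_smul, osc_eq_boundedPairing,
    crossDiff]

lemma toDistribution_smul_sub (a b : ℂ) (h k : Lp ℂ 1 (volume : Measure (Pos d))) :
    toDistribution (a • h - b • k) = a • toDistribution h - b • toDistribution k := by
  ext1 χ
  simp only [toDistribution_eq_boundedPairing, Pi.sub_apply, Pi.smul_apply, map_sub, map_smul]

/-- The Wigner representative of Wigner transforms is a difference of Schrödinger
representatives. -/
lemma wignerRep_wignerL2 {ε T : ℝ} (hε : 0 < ε) (hT : 0 < T) {V : Pos d →ᵇ ℝ}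
    {φ φ' ψ ψ' : ℝ → WaveSpace d} (hφ : IsSchrodingerSolution ε T V φ)
    (hφ' : IsSchrodingerSolution ε T V φ') (hψ : IsSchrodingerSolution ε T V ψ)
    (hψ' : IsSchrodingerSolution ε T V ψ') {f g : ℝ → PhaseSpaceL2 d}
    (hf : Set.EqOn f (fun t => wignerL2 hε (φ t) (ψ' t)) (Set.Icc 0 T))
    (hg : Set.EqOn g (fun t => wignerL2 hε (ψ t) (φ' t)) (Set.Icc 0 T)) :
    ((2 * Real.pi * ε : ℂ) ^ d) • wignerRep ε T f g =
      toDistribution ((inner ℂ (ψ' 0) (φ' 0) : ℂ) • schrodingerRep ε T φ ψ -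
        (inner ℂ (ψ 0) (φ 0) : ℂ) • schrodingerRep ε T φ' ψ') := by
  ext1 χ
  rw [Pi.smul_apply, wignerRep_of_integrand_eq (wignerRepIntegrand_zero hε hT hφ hφ' hψ hψ' hf hg)]
  simp only [toDistribution_eq_boundedPairing, crossDiff, schrodingerRep, map_sub, map_smul,
    smul_eq_mul, mul_pow]
  have : (ε : ℂ) ≠ 0 := by exact_mod_cast hε.ne'
  have : (Real.pi : ℂ) ≠ 0 := by simp [Real.pi_ne_zero]
  have := Complex.I_ne_zero
  -- The left side carries `i/ε` and the Schrödinger representatives `1/(iε) = -i/ε`; this sign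
  -- accounts for the opposite order of the two terms in `crossDiff`.
  field_simp
  rw [Complex.I_sq]
  ring

lemma ae_wignerRepAt_eq {ε T : ℝ} {f g : ℝ → PhaseSpaceL2 d} {K : ℂ}
    {H : Lp ℂ 1 (volume : Measure (Pos d))} (h : K • wignerRep ε T f g = toDistribution H)
    (hi : Integrable (wignerRepIntegrand ε T f g 0)) :
    ∀ᵐ x, K * wignerRepAt ε T f g x = H x := by
  refine ae_eq_of_integral_mul_test_eq (f := fun x => K * wignerRepAt ε T f g x) ?_
    (L1.integrable_coeFn H).locallyIntegrable fun η hη hs => ?_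
  · simp only [wignerRepAt_eq]
    have := continuous_osc hi
    exact (by fun_prop : Continuous fun x => K * (Complex.I / (2 * Real.pi : ℂ) ^ d *
      osc (wignerRepIntegrand ε T f g 0) (-x))).locallyIntegrable
  · have := congrFun h (hs.toSchwartzMap hη)
    rw [Pi.smul_apply, ← integral_wignerRepAt_mul hi, toDistribution, smul_eq_mul,
      ← integral_const_mul] at this
    simp only [mul_assoc]
    exact this

end Representatives

end InverseWigner

end

/-- The inner product `⟨u, v⟩ = ∫ u conj v`, linear in its first argument, is `inner ℂ v u` here. -/
theorem mainTheorem1 (d : ℕ) (ε T : ℝ) (hε : 0 < ε) (hT : 0 < T)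
    (Vb : BoundedContinuousFunction (EuclideanSpace ℝ (Fin d)) ℝ)
    (φI φI' ψT ψT' : InverseWigner.WaveSpace d)
    (φb φb' ψ ψ' : ℝ → InverseWigner.WaveSpace d)
    (hφb : InverseWigner.IsSchrodingerSolution ε T Vb φb) (hφI : φb 0 = φI)
    (hφb' : InverseWigner.IsSchrodingerSolution ε T Vb φb') (hφI' : φb' 0 = φI')
    (hψ : InverseWigner.IsSchrodingerSolution ε T Vb ψ) (hψT : ψ T = ψT)
    (hψ' : InverseWigner.IsSchrodingerSolution ε T Vb ψ') (hψT' : ψ' T = ψT')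
    (fI gT : InverseWigner.Phase d → ℂ)
    (hfI : fI = InverseWigner.wignerTransform ε φI (ψ' 0))
    (hgT : gT = InverseWigner.wignerTransform ε ψT (φb' T)) :
    -- existence and uniqueness of the background Wigner solution with initial data `fI`
    (∃ f : ℝ → InverseWigner.PhaseSpaceL2 d,
      (InverseWigner.IsWignerSolution ε T Vb f ∧ f 0 =ᵐ[volume] fI) ∧
      ∀ f₁ : ℝ → InverseWigner.PhaseSpaceL2 d,
        InverseWigner.IsWignerSolution ε T Vb f₁ → f₁ 0 =ᵐ[volume] fI →
          Set.EqOn f₁ f (Set.Icc 0 T)) ∧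
    -- existence and uniqueness of the adjoint Wigner solution with final data `gT`
    (∃ g : ℝ → InverseWigner.PhaseSpaceL2 d,
      (InverseWigner.IsWignerSolution ε T Vb g ∧ g T =ᵐ[volume] gT) ∧
      ∀ g₁ : ℝ → InverseWigner.PhaseSpaceL2 d,
        InverseWigner.IsWignerSolution ε T Vb g₁ → g₁ T =ᵐ[volume] gT →
          Set.EqOn g₁ g (Set.Icc 0 T)) ∧
    -- the relation between the representatives
    ∀ fb g : ℝ → InverseWigner.PhaseSpaceL2 d,
      InverseWigner.IsWignerSolution ε T Vb fb → fb 0 =ᵐ[volume] fI →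
      InverseWigner.IsWignerSolution ε T Vb g → g T =ᵐ[volume] gT →
        -- as distributions
        ((2 * Real.pi * ε : ℂ) ^ d) • InverseWigner.wignerRep ε T fb g =
          InverseWigner.toDistribution
            ((inner ℂ (ψ' 0) φI' : ℂ) • InverseWigner.schrodingerRep ε T φb ψ -
              (inner ℂ (ψ 0) φI : ℂ) • InverseWigner.schrodingerRep ε T φb' ψ') ∧
        -- pointwise, whenever the oscillatory integral converges absolutely
        (Integrable (InverseWigner.wignerRepIntegrand ε T fb g 0) volume →
          ∀ᵐ x : EuclideanSpace ℝ (Fin d),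
            (2 * Real.pi * ε : ℂ) ^ d * InverseWigner.wignerRepAt ε T fb g x =
              ((inner ℂ (ψ' 0) φI' : ℂ) • InverseWigner.schrodingerRep ε T φb ψ -
                (inner ℂ (ψ 0) φI : ℂ) • InverseWigner.schrodingerRep ε T φb' ψ' :
                Lp ℂ 1 (volume : Measure (EuclideanSpace ℝ (Fin d)))) x) ∧
        -- the Wigner representative is a linear combination of Schrödinger representatives
        InverseWigner.wignerRep ε T fb g ∈
          Submodule.span ℂ (InverseWigner.schrodingerReps ε T Vb) := by
  subst hφI hφI' hψT hψT' hfI hgT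
  have hf := InverseWigner.isWignerSolution_wignerL2 hε hT hφb hψ'
  have hf0 := InverseWigner.coeFn_wignerL2 hε (φb 0) (ψ' 0)
  have hg := InverseWigner.isWignerSolution_wignerL2 hε hT hψ hφb'
  have hgT := InverseWigner.coeFn_wignerL2 hε (ψ T) (φb' T)
  have hfu : ∀ f₁ : ℝ → InverseWigner.PhaseSpaceL2 d, InverseWigner.IsWignerSolution ε T Vb f₁ →
      f₁ 0 =ᵐ[volume] InverseWigner.wignerTransform ε (φb 0) (ψ' 0) →
      Set.EqOn f₁ (fun t => InverseWigner.wignerL2 hε (φb t) (ψ' t)) (Set.Icc 0 T) :=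
    fun f₁ h₁ h₂ => h₁.eqOn_of_initial hε hT hf (Lp.ext (h₂.trans hf0.symm))
  have hgu : ∀ g₁ : ℝ → InverseWigner.PhaseSpaceL2 d, InverseWigner.IsWignerSolution ε T Vb g₁ →
      g₁ T =ᵐ[volume] InverseWigner.wignerTransform ε (ψ T) (φb' T) →
      Set.EqOn g₁ (fun t => InverseWigner.wignerL2 hε (ψ t) (φb' t)) (Set.Icc 0 T) :=
    fun g₁ h₁ h₂ => h₁.eqOn_of_final hε hT hg (Lp.ext (h₂.trans hgT.symm))
  refine ⟨⟨_, ⟨hf, hf0⟩, hfu⟩, ⟨_, ⟨hg, hgT⟩, hgu⟩, fun f g h₁ h₂ h₃ h₄ => ?_⟩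
  have key := InverseWigner.wignerRep_wignerL2 hε hT hφb hφb' hψ hψ' (hfu f h₁ h₂) (hgu g h₃ h₄)
  refine ⟨key, InverseWigner.ae_wignerRepAt_eq key, ?_⟩
  have hK : (2 * Real.pi * ε : ℂ) ^ d ≠ 0 :=
    pow_ne_zero _ (by simp [Real.pi_ne_zero, hε.ne'])
  -- Membership in the span is unaffected by the nonzero factor `(2πε)^d`, so the identity of
  -- distributions applies directly.
  rw [← Submodule.smul_mem_iff _ hK, key, InverseWigner.toDistribution_smul_sub]
  exact Submodule.sub_mem _
    (Submodule.smul_mem _ _ (Submodule.subset_span ⟨φb, ψ, hφb, hψ, rfl⟩))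
    (Submodule.smul_mem _ _ (Submodule.subset_span ⟨φb', ψ', hφb', hψ', rfl⟩))
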